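/- Let $A\in\mathbb R^{m\times n}$, $b\in\mathbb R^m$, $c\in\mathbb R^n$ and $K=\{x\in\mathbb R^n : l\le x\le u\}$, where the components of $l,u$ may be $\pm\infty$, and consider $$(P)\ \min\{c^Tx+\delta_K(x) : Ax=b\},\qquad (D)\ \max\{-\delta_K^*(A^Ty-c)+b^Ty : y\in\mathbb R^m\},$$ with $\delta_K$ the indicator function of $K$ and $\delta_K^*$ its conjugate. Assume that $(P)$ and $(D)$ have optimal solutions and that $A$ has full row rank. Let $$\mathcal T_l(y,x)=\{(y',x') : y'=-b+Ax,\ x'\in c-A^Ty+\partial\delta_K(x)\},\qquad \Omega=\mathcal T_l^{-1}(0)$$ ($\Omega$ is the set of KKT points). For a positive definite $M$ write $\|z\|_M=\sqrt{\langle z,Mz\rangle}$ and $\mathrm{dist}_M(z,D)=\inf_{w\in D}\|z-w\|_M$; $\mathrm{dist}$ is the Euclidean distance. For every $r>0$ there is $\kappa>0$ such that $$\mathrm{dist}(z,\Omega)\le\kappa\,\mathrm{dist}(0,\mathcal T_l(z))\quad\text{for all } z \text{ with } \mathrm{dist}(z,\Omega)\le r. \qquad (1)$$ Let $0<\sigma_k\uparrow\sigma_\infty\le\infty$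 be nondecreasing, let $\tau_k\downarrow\tau_\infty>0$ be nonincreasing, let $\epsilon_k\ge0$ and $0\le\delta_k<1$ be summable, let $r>\sum_{k}\epsilon_k$, and let $\kappa>0$ satisfy (1) for this $r$. Put $\Lambda_k=\mathrm{Diag}(\tau_kI_m,I_n)$, $\gamma_k=\max(\tau_k,1)$, $\gamma_\infty=\max(\tau_\infty,1)$. Let $L_\sigma(y;x)=\sup_{s\in K}\{-b^Ty-\langle s,c-A^Ty\rangle-\frac1{2\sigma}\|s-x\|^2\}$ be the augmented Lagrangian and $\psi_k(y)=L_{\sigma_k}(y;x^k)+\frac{\tau_k}{2\sigma_k}\|y-y^k\|^2$. Let $z^k=(y^k,x^k)$, $k\ge0$, be a sequence generated by the inexact proximal augmented Lagrangian method SNIPAL: for every $k\ge0$, $x^{k+1}=\Pi_K\big(x^k-\sigma_k(c-A^Ty^{k+1})\big)$, and $y^{k+1}$ satisfies the stopping criteria $$(A')\ \ \|\nabla\psi_k(y^{k+1})\|\le\frac{\min(\sqrt{\tau_k},1)}{\sigma_k}\,\epsilon_k,\qquad (B')\ \ \|\nabla\psi_k(y^{k+1})\|\le\frac{\delta_k\min(\sqrt{\tau_k},1)}{\sigma_k}\,\|z^{k+1}-z^k\|_{\Lambda_k}.$$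 Suppose that $\mathrm{dist}_{\Lambda_0}(z^0,\Omega)\le r-\sum_{k}\epsilon_k$. Then for all $k\ge0$ $$\mathrm{dist}_{\Lambda_{k+1}}(z^{k+1},\Omega)\le\mu_k\,\mathrm{dist}_{\Lambda_k}(z^k,\Omega),\qquad \mathrm{dist}(z^{k+1},\Omega)\le\frac{\mu_k}{\sqrt{\min(1,\tau_{k+1})}}\,\mathrm{dist}_{\Lambda_k}(z^k,\Omega),$$ where $$\mu_k=(1-\delta_k)^{-1}\Big(\delta_k+(1+\delta_k)\frac{\kappa\gamma_k}{\sqrt{\sigma_k^2+\kappa^2\gamma_k^2}}\Big),$$ and $$\lim_{k\to\infty}\mu_k=\mu_\infty=\frac{\kappa\gamma_\infty}{\sqrt{\sigma_\infty^2+\kappa^2\gamma_\infty^2}}<1\qquad(\mu_\infty=0\ \text{if}\ \sigma_\infty=\infty).$$ -/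

import Mathlib

open Filter Topology
open scoped ENNReal

namespace Snipal

noncomputable section

/-- Euclidean space of dimension `d`. -/
abbrev E (d : ℕ) := EuclideanSpace ℝ (Fin d)

/-- The space of pairs `z = (y, x)`, with the Euclidean (product) inner product. -/
abbrev Z (m n : ℕ) := WithLp 2 (E m × E n)

/-- The pair `(y, x)` as a point of `Z m n`. -/
abbrev pair {m n : ℕ} (y : E m) (x : E n) : Z m n := WithLp.toLp 2 (y, x)

/-! ### Convex analysis and weighted distances -/

/-- The indicator function of `K` in the sense of convex analysis: `0` on `K`, `∞` off `K`. -/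
def indicatorFn {d : ℕ} (K : Set (E d)) (x : E d) : EReal :=
  open Classical in if x ∈ K then 0 else ⊤

/-- The Fenchel conjugate of an extended real valued function. -/
def conjugate {d : ℕ} (f : E d → EReal) (s : E d) : EReal :=
  ⨆ x : E d, ((inner ℝ x s : ℝ) : EReal) - f x

/-- The subdifferential of an extended real valued convex function. -/
def subdifferential {d : ℕ} (f : E d → EReal) (x : E d) : Set (E d) :=
  {v | ∀ w : E d, f x + ((inner ℝ v (w - x) : ℝ) : EReal) ≤ f w}

/-- `p` is the Euclidean projection of `v` onto `K`. -/
def IsProj {d : ℕ} (K : Set (E d)) (v p : E d) : Prop :=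
  p ∈ K ∧ ∀ q ∈ K, ‖v - p‖ ≤ ‖v - q‖

/-- The weighted norm `‖z‖_M = √⟨z, M z⟩`. -/
def wnorm {V : Type*} [NormedAddCommGroup V] [InnerProductSpace ℝ V]
    (M : V →ₗ[ℝ] V) (z : V) : ℝ :=
  √(inner ℝ z (M z))

/-- The weighted distance `dist_M(z, D) = inf_{w ∈ D} ‖z - w‖_M`, with `inf ∅ = ∞`. -/
def wdist {V : Type*} [NormedAddCommGroup V] [InnerProductSpace ℝ V]
    (M : V →ₗ[ℝ] V) (z : V) (D : Set V) : ℝ≥0∞ :=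
  ⨅ w ∈ D, ENNReal.ofReal (wnorm M (z - w))

/-- The block diagonal operator `Diag(t I_m, I_n)`. -/
def Lam (m n : ℕ) (t : ℝ) : Z m n →ₗ[ℝ] Z m n where
  toFun z := pair (t • z.fst) z.snd
  map_add' z w := by
    apply (WithLp.equiv 2 (E m × E n)).injective
    ext <;> simp
  map_smul' a z := by
    apply (WithLp.equiv 2 (E m × E n)).injective
    ext <;> simp
    ring

/-! ### The linear programs -/

/-- The data of the primal-dual pair of linear programs
`(P) min {cᵀx + δ_K(x) | Ax = b}` and `(D) max {-δ_K*(Aᵀy - c) + bᵀy}`,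
where `K = {x | lo ≤ x ≤ up}` with possibly infinite bounds. -/
structure LP (m n : ℕ) where
  A : Matrix (Fin m) (Fin n) ℝ
  b : E m
  c : E n
  lo : Fin n → EReal
  up : Fin n → EReal

namespace LP

variable {m n : ℕ} (P : LP m n)

/-- `x ↦ A x`. -/
def Amap : E n →ₗ[ℝ] E m := Matrix.toEuclideanLin P.A

/-- `y ↦ Aᵀ y`. -/
def Aadj : E m →ₗ[ℝ] E n := Matrix.toEuclideanLin P.A.transpose

/-- The box `K`. -/
def K : Set (E n) := {x | ∀ i, P.lo i ≤ (x i : EReal) ∧ (x i : EReal) ≤ P.up i}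

/-- Objective function of (P). -/
def primalObj (x : E n) : EReal := ((inner ℝ P.c x : ℝ) : EReal) + indicatorFn P.K x

/-- Objective function of (D). -/
def dualObj (y : E m) : EReal :=
  -conjugate (indicatorFn P.K) (P.Aadj y - P.c) + ((inner ℝ P.b y : ℝ) : EReal)

/-- `x` is an optimal solution of (P). -/
def IsPrimalSol (x : E n) : Prop :=
  P.Amap x = P.b ∧ P.primalObj x ≠ ⊤ ∧ ∀ x', P.Amap x' = P.b → P.primalObj x ≤ P.primalObj x'

/-- `y` is an optimal solution of (D). -/
def IsDualSol (y : E m) : Prop :=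
  P.dualObj y ≠ ⊥ ∧ ∀ y', P.dualObj y' ≤ P.dualObj y

/-- The maximal monotone operator
`T_l(y, x) = {(y', x') | y' = -b + A x, x' ∈ c - Aᵀ y + ∂δ_K(x)}` of the Lagrangian `l`. -/
def T (z : Z m n) : Set (Z m n) :=
  {w | w.fst = -P.b + P.Amap z.snd ∧
    ∃ v ∈ subdifferential (indicatorFn P.K) z.snd, w.snd = P.c - P.Aadj z.fst + v}

/-- The set `T_l⁻¹(0)` of KKT points. -/
def kkt : Set (Z m n) := {z | 0 ∈ P.T z}

/-- The error bound `dist(z, T_l⁻¹(0)) ≤ κ dist(0, T_l(z))`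
for all `z` with `dist(z, T_l⁻¹(0)) ≤ r` (Euclidean distances, `dist(0, ∅) = ∞`). -/
def ErrorBound (r κ : ℝ) : Prop :=
  ∀ z : Z m n, Metric.infEDist z P.kkt ≤ ENNReal.ofReal r →
    Metric.infEDist z P.kkt ≤ ENNReal.ofReal κ * Metric.infEDist 0 (P.T z)

/-! ### The algorithm -/

/-- The augmented Lagrangian
`L_σ(y; x) = sup_s {l(y; s) - ‖s - x‖² / (2σ)}`, where
`l(y; s) = -bᵀy - ⟨s, c - Aᵀy⟩ - δ_K(s)`; the supremum may be taken over `s ∈ K`. -/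
def augLag (σ : ℝ) (y : E m) (x : E n) : ℝ :=
  sSup ((fun s : E n =>
    -(inner ℝ P.b y) - inner ℝ s (P.c - P.Aadj y) - 1 / (2 * σ) * ‖s - x‖ ^ 2) '' P.K)

/-- The objective `ψ(y) = L_σ(y; x̄) + τ / (2σ) ‖y - ȳ‖²` of the inner subproblem. -/
def psi (σ τ : ℝ) (ybar : E m) (xbar : E n) (y : E m) : ℝ :=
  P.augLag σ y xbar + τ / (2 * σ) * ‖y - ybar‖ ^ 2

/-- The sequence `(y k, x k)` is generated by the inexact proximal augmented Lagrangian
iteration with parameters `σ k`, `τ k`, where `y (k + 1)` is an approximate minimizer of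
`ψ_k` accepted by both stopping criteria (A') and (B'). -/
structure IsSnipalSeq (σ τ ε δ : ℕ → ℝ) (y : ℕ → E m) (x : ℕ → E n) : Prop where
  /-- criterion (A') -/
  critA : ∀ k, ‖gradient (P.psi (σ k) (τ k) (y k) (x k)) (y (k + 1))‖ ≤
    min √(τ k) 1 / σ k * ε k
  /-- criterion (B') -/
  critB : ∀ k, ‖gradient (P.psi (σ k) (τ k) (y k) (x k)) (y (k + 1))‖ ≤
    δ k * min √(τ k) 1 / σ k *
      wnorm (Lam m n (τ k)) (pair (y (k + 1)) (x (k + 1)) - pair (y k) (x k))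
  /-- the multiplier update `x^{k+1} = Π_K (x^k - σ_k (c - Aᵀ y^{k+1}))` -/
  update : ∀ k, IsProj P.K (x k - σ k • (P.c - P.Aadj (y (k + 1)))) (x (k + 1))

end LP

/-- The rate `(1 - δ)⁻¹ (δ + (1 + δ) κ γ / √(σ² + κ² γ²))` with `γ = max (τ, 1)`. -/
def rate (κ σ τ δ : ℝ) : ℝ :=
  (1 - δ)⁻¹ * (δ + (1 + δ) * (κ * max τ 1) / √(σ ^ 2 + κ ^ 2 * max τ 1 ^ 2))

/-- The limit rate `κ γ_∞ / √(σ_∞² + κ² γ_∞²)` with `γ_∞ = max (τ_∞, 1)`, and `0` if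
`σ_∞ = ∞`. -/
def limitRate (κ : ℝ) (σinf : EReal) (τinf : ℝ) : ℝ :=
  if σinf = ⊤ then 0
  else κ * max τinf 1 / √(σinf.toReal ^ 2 + κ ^ 2 * max τinf 1 ^ 2)

end

end Snipal

/-! The method is an inexact, preconditioned proximal point iteration. If `g` is the gradient of the
subproblem at the new `y`, the projection step says that `(g, 0) + σ⁻¹ Λ (zᵏ - zᵏ⁺¹)` lies in `T` at
`zᵏ⁺¹`. With `g = 0` this defines the exact step `a`.

Three estimates give the rate. Write `D`, `d` for the weighted distances of `zᵏ`, `a` to the KKT set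
and `N` for the weighted length of `zᵏ - a`. Monotonicity of `T` against KKT points gives `d² + N² ≤
D²`. The error bound at `a`, whose residual is `σ⁻¹ Λ (zᵏ - a)`, gives `σ d ≤ κ γ N`. Eliminating
`N` leaves `d ≤ κγ / √(σ² + κ²γ²) · D` (`lamDist_resolvent_le`). Monotonicity also bounds the
weighted gap between the inexact and the exact step by the gradient (`norm_Lam_sub_resolvent_le`):
(A') keeps the iterates within weighted distance `r`, and (B') turns the exact rate into `rate`.

The delicate point is that the error bound is Euclidean while only the weighted distance is known to
be at most `r`; for `τ < 1` the point `a` may lie outside the Euclidean neighbourhood.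
`ErrorBound.min_infDist_le` repairs this: beyond radius `r` the residual is still at least `r / κ`,
by continuity along the resolvent path.

Existence of `κ` is Hoffman's lemma, proved by Fourier–Motzkin elimination and applied to the
finitely many polyhedral pieces of the KKT set, one for each sign pattern of the reduced costs. -/

namespace Snipal

/-! ### Hoffman's lemma by Fourier–Motzkin elimination -/

/-- A real number that nearly satisfies finitely many compatible bounds can be moved by the same
amount so as to satisfy all of them. -/
theorem exists_clamp {I J : Type*} [Finite I] [Finite J] (L : J → ℝ) (U : I → ℝ) {t e : ℝ}
    (he : 0 ≤ e) (hLU : ∀ j i, L j ≤ U i) (hU : ∀ i, t ≤ U i + e) (hL : ∀ j, L j ≤ t + e) :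
    ∃ t', (∀ i, t' ≤ U i) ∧ (∀ j, L j ≤ t') ∧ |t' - t| ≤ e := by
  by_cases h1 : ∃ j, t < L j
  · obtain ⟨j0, hj0⟩ := h1
    have : Nonempty J := ⟨j0⟩
    obtain ⟨j, hj⟩ := Finite.exists_max L
    refine ⟨L j, hLU j, hj, ?_⟩
    have := hj j0
    have := hL j
    rw [abs_le]
    constructor <;> linarith
  · push Not at h1
    by_cases h2 : ∃ i, U i < t
    · obtain ⟨i0, hi0⟩ := h2
      have : Nonempty I := ⟨i0⟩
      obtain ⟨i, hi⟩ := Finite.exists_min U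
      refine ⟨U i, hi, fun j => hLU j i, ?_⟩
      have := hi i0
      have := hU i
      rw [abs_le]
      constructor <;> linarith
    · push Not at h2
      exact ⟨t, h2, h1, by simpa using he⟩

/-- **Hoffman's lemma** in coordinates, including the infeasible case: points which violate the
finitely many linear inequalities by less than `η` are close to solutions. -/
theorem exists_hoffman_pi (d : ℕ) : ∀ {ι : Type} [Finite ι] (a : ι → Fin d → ℝ) (b : ι → ℝ),
    ∃ κ > 0, ∃ η > 0, ∀ (ρ : ℝ) (x : Fin d → ℝ), 0 ≤ ρ → ρ < η →
      (∀ i, a i ⬝ᵥ x ≤ b i + ρ) → ∃ x', (∀ i, a i ⬝ᵥ x' ≤ b i) ∧ ∀ j, |x' j - x j| ≤ κ * ρ := by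
  induction d with
  | zero =>
    intro ι _ a b
    by_cases h : ∃ i, b i < 0
    · obtain ⟨i, hi⟩ := h
      -- An infeasible system: with this `η` no point violates it by less than `η`, so the claim is
      -- vacuous.
      refine ⟨1, one_pos, -b i, by linarith, fun ρ x _ hρ hx => ?_⟩
      have := hx i
      simp at this
      linarith
    · push Not at h
      exact ⟨1, one_pos, 1, one_pos, fun ρ x _ _ _ => ⟨x, fun i => by simpa using h i,
        fun j => j.elim0⟩⟩
  | succ d ih =>
    intro ι _ a b
    classical
    cases nonempty_fintype ι
    -- the rows of the system obtained by eliminating the first variable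
    let s : ι → ℝ := fun i => a i 0
    let q : ι → Fin d → ℝ := fun i => Fin.tail (a i)
    have hdot : ∀ i (x : Fin (d + 1) → ℝ), a i ⬝ᵥ x = s i * x 0 + q i ⬝ᵥ Fin.tail x := by
      intro i x
      simp [dotProduct, Fin.sum_univ_succ, s, q, Fin.tail]
    let a' : {i // s i = 0} ⊕ {i // 0 < s i} × {i // s i < 0} → Fin d → ℝ :=
      Sum.elim (fun i => q i) (fun p => (s p.1)⁻¹ • q p.1 - (s p.2)⁻¹ • q p.2)
    let b' : {i // s i = 0} ⊕ {i // 0 < s i} × {i // s i < 0} → ℝ :=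
      Sum.elim (fun i => b i) (fun p => (s p.1)⁻¹ * b p.1 - (s p.2)⁻¹ * b p.2)
    obtain ⟨κ, hκ, η, hη, H⟩ := ih a' b'
    let M : ℝ := 1 + ∑ i, |(s i)⁻¹|
    have hM1 : 1 ≤ M := le_add_of_nonneg_right (Finset.sum_nonneg fun i _ => abs_nonneg _)
    have hM : ∀ i, |(s i)⁻¹| ≤ M := fun i =>
      (Finset.single_le_sum (f := fun i => |(s i)⁻¹|) (fun i _ => abs_nonneg _)
        (Finset.mem_univ i)).trans (by simp [M])
    let Q : ℝ := ∑ i, ∑ j, |q i j|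
    have hQ0 : 0 ≤ Q := Finset.sum_nonneg fun i _ => Finset.sum_nonneg fun j _ => abs_nonneg _
    have hQ : ∀ i (u : Fin d → ℝ) (e : ℝ), (∀ j, |u j| ≤ e) → 0 ≤ e → |q i ⬝ᵥ u| ≤ Q * e := by
      intro i u e hu he
      calc |q i ⬝ᵥ u| ≤ ∑ j, |q i j * u j| := Finset.abs_sum_le_sum_abs _ _
        _ ≤ ∑ j, |q i j| * e := Finset.sum_le_sum fun j _ => by
            rw [abs_mul]; exact mul_le_mul_of_nonneg_left (hu j) (abs_nonneg _)
        _ = (∑ j, |q i j|) * e := by rw [Finset.sum_mul]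
        _ ≤ Q * e := mul_le_mul_of_nonneg_right
            (Finset.single_le_sum (f := fun i => ∑ j, |q i j|)
              (fun i _ => Finset.sum_nonneg fun j _ => abs_nonneg _) (Finset.mem_univ i)) he
    have hM0 : 0 < M := by linarith
    -- `N * ρ` is how far the bounds on the first variable can move when `ρ` is removed from the
    -- right-hand sides and the other variables shift by `κ * (2 * M * ρ)`.
    let N : ℝ := M * (1 + Q * (κ * (2 * M)))
    have hN : 0 ≤ N := by positivity
    refine ⟨κ * (2 * M) + N, by positivity, η / (2 * M), by positivity,
      fun ρ x hρ hρη hx => ?_⟩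
    have hx' : ∀ i, s i * x 0 + q i ⬝ᵥ Fin.tail x ≤ b i + ρ := fun i => by
      rw [← hdot]; exact hx i
    -- A combined row adds two violations, each scaled by some `|(s i)⁻¹| ≤ M`; hence `2 * M * ρ`,
    -- and the threshold `η / (2 * M)`.
    obtain ⟨x', hx1, hx2⟩ := H (2 * M * ρ) (Fin.tail x) (by positivity)
      (by rw [lt_div_iff₀ (by positivity)] at hρη; linarith) (by
        rintro (⟨i, hi⟩ | ⟨⟨i, hi⟩, ⟨j, hj⟩⟩)
        · have := hx' i
          rw [hi, zero_mul, zero_add] at this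
          simp only [a', b', Sum.elim_inl]
          nlinarith
        · simp only [a', b', Sum.elim_inr, sub_dotProduct, smul_dotProduct, smul_eq_mul]
          have h1 := mul_le_mul_of_nonneg_left (hx' i) (inv_pos.2 hi).le
          have h2 := mul_le_mul_of_nonpos_left (hx' j) (inv_lt_zero.2 hj).le
          rw [mul_add, mul_add, ← mul_assoc, inv_mul_cancel₀ hi.ne'] at h1
          rw [mul_add, mul_add, ← mul_assoc, inv_mul_cancel₀ hj.ne] at h2
          have h3 := mul_le_mul_of_nonneg_right ((le_abs_self _).trans (hM i)) hρ
          have h4 := mul_le_mul_of_nonneg_right ((neg_le_abs _).trans (hM j)) hρ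
          linarith)
    have hdiff : ∀ i, |q i ⬝ᵥ x' - q i ⬝ᵥ Fin.tail x| ≤ Q * (κ * (2 * M)) * ρ := by
      intro i
      rw [← dotProduct_sub]
      exact (hQ i _ (κ * (2 * M * ρ)) hx2 (by positivity)).trans_eq (by ring)
    have hsl : ∀ i, |(s i)⁻¹| * (b i + ρ - q i ⬝ᵥ Fin.tail x) ≤
        |(s i)⁻¹| * (b i - q i ⬝ᵥ x') + N * ρ := by
      intro i
      have h1 : b i + ρ - q i ⬝ᵥ Fin.tail x ≤ b i - q i ⬝ᵥ x' + (1 + Q * (κ * (2 * M))) * ρ := by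
        have := (abs_le.1 (hdiff i)).2
        linarith
      have h2 := mul_le_mul_of_nonneg_left h1 (abs_nonneg (s i)⁻¹)
      have h3 := mul_le_mul_of_nonneg_right (hM i)
        (show 0 ≤ (1 + Q * (κ * (2 * M))) * ρ by positivity)
      rw [mul_add] at h2
      have h4 : N * ρ = M * ((1 + Q * (κ * (2 * M))) * ρ) := by simp only [N]; ring
      linarith
    obtain ⟨t, ht1, ht2, ht3⟩ := exists_clamp
      (fun j : {i // s i < 0} => (s j)⁻¹ * (b j - q j ⬝ᵥ x'))
      (fun i : {i // 0 < s i} => (s i)⁻¹ * (b i - q i ⬝ᵥ x')) (t := x 0) (e := N * ρ)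
      (by positivity)
      (by
        intro j i
        have := hx1 (Sum.inr (i, j))
        simp only [a', b', Sum.elim_inr, sub_dotProduct, smul_dotProduct, smul_eq_mul] at this
        linarith)
      (by
        rintro ⟨i, hi⟩
        have h1 := hsl i
        rw [abs_of_pos (inv_pos.2 hi)] at h1
        have h2 := mul_le_mul_of_nonneg_left (hx' i) (inv_pos.2 hi).le
        rw [mul_add, ← mul_assoc, inv_mul_cancel₀ hi.ne'] at h2
        simp only
        linarith)
      (by
        rintro ⟨i, hi⟩
        have h1 := hsl i
        rw [abs_of_neg (inv_lt_zero.2 hi)] at h1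
        have h2 := mul_le_mul_of_nonpos_left (hx' i) (inv_lt_zero.2 hi).le
        rw [mul_add (s i)⁻¹ (s i * x 0), ← mul_assoc, inv_mul_cancel₀ hi.ne] at h2
        simp only
        linarith)
    refine ⟨Fin.cons t x', fun i => ?_, fun j => ?_⟩
    · rw [hdot, Fin.cons_zero, Fin.tail_cons]
      rcases lt_trichotomy (s i) 0 with hi | hi | hi
      · have := mul_le_mul_of_nonpos_left (ht2 ⟨i, hi⟩) hi.le
        rw [← mul_assoc, mul_inv_cancel₀ hi.ne] at this
        linarith
      · have := hx1 (Sum.inl ⟨i, hi⟩)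
        simp only [a', b', Sum.elim_inl] at this
        rw [hi]
        linarith
      · have := mul_le_mul_of_nonneg_left (ht1 ⟨i, hi⟩) hi.le
        rw [← mul_assoc, mul_inv_cancel₀ hi.ne'] at this
        linarith
    · refine Fin.cases ?_ (fun j => ?_) j
      · rw [Fin.cons_zero]
        refine ht3.trans (mul_le_mul_of_nonneg_right ?_ hρ)
        linarith [show 0 ≤ κ * (2 * M) by positivity]
      · rw [Fin.cons_succ]
        refine (hx2 j).trans ?_
        rw [← mul_assoc]
        exact mul_le_mul_of_nonneg_right (by linarith) hρ

theorem exists_dotProduct_eq {V : Type*} [NormedAddCommGroup V] [NormedSpace ℝ V] {d : ℕ}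
    (e : V ≃L[ℝ] (Fin d → ℝ)) (f : V →ₗ[ℝ] ℝ) : ∃ a : Fin d → ℝ, ∀ x, a ⬝ᵥ e x = f x := by
  refine ⟨fun j => f (e.symm (Pi.single j 1)), fun x => ?_⟩
  have h : x = ∑ j, e x j • e.symm (Pi.single j 1) := by
    apply e.injective
    simp only [map_sum, map_smul, ContinuousLinearEquiv.apply_symm_apply]
    exact pi_eq_sum_univ' (e x)
  conv_rhs => rw [h]
  simp [dotProduct, mul_comm]

/-- Hoffman's lemma for two-sided, possibly infinite bounds on linear functionals. -/
theorem exists_hoffman {V : Type*} [NormedAddCommGroup V] [NormedSpace ℝ V]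
    [FiniteDimensional ℝ V] {ι : Type} [Finite ι] (g : ι → V →ₗ[ℝ] ℝ) (l u : ι → EReal) :
    ∃ κ > 0, ∃ η > 0, ∀ (ρ : ℝ) (x : V), 0 ≤ ρ → ρ < η →
      (∀ i, l i ≤ ((g i x + ρ : ℝ) : EReal) ∧ ((g i x - ρ : ℝ) : EReal) ≤ u i) →
      ∃ x', (∀ i, l i ≤ (g i x' : EReal) ∧ (g i x' : EReal) ≤ u i) ∧ ‖x' - x‖ ≤ κ * ρ := by
  by_cases hfin : ∀ i, l i ≠ ⊤ ∧ u i ≠ ⊥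
  swap
  · push Not at hfin
    obtain ⟨i, hi⟩ := hfin
    refine ⟨1, one_pos, 1, one_pos, fun ρ x _ _ h => ?_⟩
    exfalso
    by_cases hl : l i = ⊤
    · have := (h i).1
      rw [hl, top_le_iff] at this
      exact EReal.coe_ne_top _ this
    · have := (h i).2
      rw [hi hl, le_bot_iff] at this
      exact EReal.coe_ne_bot _ this
  obtain ⟨e⟩ : Nonempty (V ≃L[ℝ] (Fin (Module.finrank ℝ V) → ℝ)) :=
    ⟨(Module.finBasis ℝ V).equivFunL⟩
  choose row hrow using exists_dotProduct_eq e
  -- Only finite bounds become rows; lower bounds enter with reversed sign.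
  obtain ⟨κ, hκ, η, hη, H⟩ := exists_hoffman_pi (Module.finrank ℝ V)
    (ι := {i // l i ≠ ⊥} ⊕ {i // u i ≠ ⊤})
    (Sum.elim (fun i => -row (g i)) (fun i => row (g i)))
    (Sum.elim (fun i => -(l i).toReal) (fun i => (u i).toReal))
  set C : ℝ := ‖(e.symm : (Fin (Module.finrank ℝ V) → ℝ) →L[ℝ] V)‖ with hC
  have hC0 : 0 ≤ C := norm_nonneg _
  refine ⟨(C + 1) * κ, by positivity, η, hη, fun ρ x hρ hρη hx => ?_⟩
  obtain ⟨x', hx1, hx2⟩ := H ρ (e x) hρ hρη (by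
    rintro (⟨i, hi⟩ | ⟨i, hi⟩)
    · have h := (hx i).1
      rw [← EReal.coe_toReal (hfin i).1 hi, EReal.coe_le_coe_iff] at h
      simp only [Sum.elim_inl, neg_dotProduct, hrow]
      linarith
    · have h := (hx i).2
      rw [← EReal.coe_toReal hi (hfin i).2, EReal.coe_le_coe_iff] at h
      simp only [Sum.elim_inr, hrow]
      linarith)
  refine ⟨e.symm x', fun i => ⟨?_, ?_⟩, ?_⟩
  · by_cases hi : l i = ⊥
    · rw [hi]; exact bot_le
    · have h := hx1 (Sum.inl ⟨i, hi⟩)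
      rw [← e.apply_symm_apply x'] at h
      simp only [Sum.elim_inl, neg_dotProduct, hrow] at h
      rw [← EReal.coe_toReal (hfin i).1 hi, EReal.coe_le_coe_iff]
      linarith
  · by_cases hi : u i = ⊤
    · rw [hi]; exact le_top
    · have h := hx1 (Sum.inr ⟨i, hi⟩)
      rw [← e.apply_symm_apply x'] at h
      simp only [Sum.elim_inr, hrow] at h
      rw [← EReal.coe_toReal hi (hfin i).2, EReal.coe_le_coe_iff]
      exact h
  · have h1 : e.symm x' - x = e.symm (x' - e x) := by simp
    have h2 : ‖x' - e x‖ ≤ κ * ρ := (pi_norm_le_iff_of_nonneg (by positivity)).2 hx2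
    rw [h1]
    calc ‖e.symm (x' - e x)‖ ≤ C * ‖x' - e x‖ :=
          (e.symm : (Fin (Module.finrank ℝ V) → ℝ) →L[ℝ] V).le_opNorm _
      _ ≤ (C + 1) * (κ * ρ) := mul_le_mul (by linarith) h2 (norm_nonneg _) (by linarith)
      _ = (C + 1) * κ * ρ := by ring

end Snipal

namespace Snipal

/-! ### Projections onto the box and the augmented Lagrangian -/

theorem IsProj.inner_le {d : ℕ} {K : Set (E d)} (hK : Convex ℝ K) {v p : E d} (h : IsProj K v p)
    {q : E d} (hq : q ∈ K) : inner ℝ (v - p) (q - p) ≤ 0 := by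
  have hne : Nonempty K := ⟨⟨p, h.1⟩⟩
  refine (norm_eq_iInf_iff_real_inner_le_zero hK h.1).1 (le_antisymm ?_ ?_) q hq
  · exact le_ciInf fun w => h.2 w w.2
  · exact ciInf_le ⟨0, Set.forall_mem_range.2 fun _ => norm_nonneg _⟩ (⟨p, h.1⟩ : K)

theorem exists_isProj {d : ℕ} {K : Set (E d)} (hK : Convex ℝ K) (hc : IsClosed K)
    (hne : K.Nonempty) (v : E d) : ∃ p, IsProj K v p := by
  obtain ⟨p, hp, h⟩ := exists_norm_eq_iInf_of_complete_convex hne hc.isComplete hK v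
  refine ⟨p, hp, fun q hq => ?_⟩
  rw [h]
  exact ciInf_le ⟨0, Set.forall_mem_range.2 fun _ => norm_nonneg _⟩ (⟨q, hq⟩ : K)

theorem IsProj.norm_sub_le {d : ℕ} {K : Set (E d)} (hK : Convex ℝ K) {v p v' p' : E d}
    (h : IsProj K v p) (h' : IsProj K v' p') : ‖p' - p‖ ≤ ‖v' - v‖ := by
  have h1 := h.inner_le hK h'.1
  have h2 := h'.inner_le hK h.1
  have h3 : ‖p' - p‖ ^ 2 ≤ inner ℝ (v' - v) (p' - p) := by
    have e1 : inner ℝ (v' - p') (p - p') = -inner ℝ (v' - p') (p' - p) := by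
      rw [← inner_neg_right, neg_sub]
    have e2 : inner ℝ (v' - v) (p' - p) = inner ℝ (v' - p') (p' - p) - inner ℝ (v - p) (p' - p)
        + ‖p' - p‖ ^ 2 := by
      rw [← real_inner_self_eq_norm_sq, ← inner_sub_left, ← inner_add_left]
      congr 1
      abel
    linarith
  have h4 := h3.trans (real_inner_le_norm _ _)
  by_contra hlt
  push Not at hlt
  nlinarith [norm_nonneg (v' - v)]

namespace LP

variable {m n : ℕ} (P : LP m n)

theorem inner_Aadj (s : E n) (y : E m) : inner ℝ s (P.Aadj y) = inner ℝ (P.Amap s) y := by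
  have h : P.Aadj = LinearMap.adjoint P.Amap := by
    rw [Aadj, Amap, ← Matrix.toEuclideanLin_conjTranspose_eq_adjoint]
    congr 1
  rw [h, LinearMap.adjoint_inner_right]

theorem convex_K : Convex ℝ P.K := by
  have h : P.K = ⋂ i, (fun x : E n => x i) ⁻¹' (Real.toEReal ⁻¹' Set.Icc (P.lo i) (P.up i)) := by
    ext x
    simp [K]
  rw [h]
  refine convex_iInter fun i => ?_
  have : (Real.toEReal ⁻¹' Set.Icc (P.lo i) (P.up i)).OrdConnected :=
    Set.ordConnected_Icc.preimage_mono EReal.coe_strictMono.monotone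
  exact this.convex.is_linear_preimage ⟨fun _ _ => rfl, fun _ _ => rfl⟩

theorem isClosed_K : IsClosed P.K := by
  have h : P.K = ⋂ i, (fun x : E n => (x i : EReal)) ⁻¹' (Set.Icc (P.lo i) (P.up i)) := by
    ext x
    simp [K]
  rw [h]
  refine isClosed_iInter fun i => isClosed_Icc.preimage ?_
  exact continuous_coe_real_ereal.comp (by fun_prop)

theorem nonempty_K (hP : ∃ x, P.IsPrimalSol x) : P.K.Nonempty := by
  obtain ⟨x, -, hx, -⟩ := hP
  refine ⟨x, ?_⟩
  by_contra h
  exact hx (by simp [primalObj, indicatorFn, h])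

/-- The Lagrangian term whose supremum over `s ∈ K` is the augmented Lagrangian. -/
noncomputable def proxLag (σ : ℝ) (y : E m) (x s : E n) : ℝ :=
  -(inner ℝ P.b y) - inner ℝ s (P.c - P.Aadj y) - 1 / (2 * σ) * ‖s - x‖ ^ 2

/-- Completing the square writes the gap as `‖s - p‖²` minus twice the inner product in the
variational inequality of the projection, up to the factor `1 / (2σ)`. -/
theorem proxLag_le {σ : ℝ} (hσ : 0 < σ) {y : E m} {x p s : E n}
    (hp : IsProj P.K (x - σ • (P.c - P.Aadj y)) p) (hs : s ∈ P.K) :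
    P.proxLag σ y x s ≤ P.proxLag σ y x p := by
  have h := hp.inner_le P.convex_K hs
  set q := P.c - P.Aadj y
  have e1 : ‖s - x‖ ^ 2 = ‖s - p‖ ^ 2 + 2 * inner ℝ (s - p) (p - x) + ‖p - x‖ ^ 2 := by
    rw [← norm_add_sq_real]
    congr 2
    abel
  have e2 : inner ℝ (x - σ • q - p) (s - p) = -σ * inner ℝ s q + σ * inner ℝ p q
      - inner ℝ (s - p) (p - x) := by
    rw [real_inner_comm, show x - σ • q - p = -(σ • q) - (p - x) by abel, inner_sub_right,
      inner_neg_right, inner_smul_right, inner_sub_left]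
    ring
  have e3 : P.proxLag σ y x p - P.proxLag σ y x s = 1 / (2 * σ) *
      (‖s - p‖ ^ 2 - 2 * inner ℝ (x - σ • q - p) (s - p)) := by
    rw [e2, proxLag, proxLag, e1]
    field_simp
    ring
  have : 0 ≤ 1 / (2 * σ) * (‖s - p‖ ^ 2 - 2 * inner ℝ (x - σ • q - p) (s - p)) := by
    apply mul_nonneg (by positivity)
    nlinarith [sq_nonneg ‖s - p‖]
  linarith

theorem augLag_eq {σ : ℝ} (hσ : 0 < σ) {y : E m} {x p : E n}
    (hp : IsProj P.K (x - σ • (P.c - P.Aadj y)) p) :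
    P.augLag σ y x = P.proxLag σ y x p := by
  refine IsGreatest.csSup_eq ⟨⟨p, hp.1, rfl⟩, ?_⟩
  rintro _ ⟨s, hs, rfl⟩
  exact P.proxLag_le hσ hp hs

theorem proxLag_sub (σ : ℝ) (y y' : E m) (x s : E n) :
    P.proxLag σ y' x s - P.proxLag σ y x s = inner ℝ (-P.b + P.Amap s) (y' - y) := by
  simp only [proxLag, inner_sub_right, inner_add_left, inner_neg_left, P.inner_Aadj]
  ring

/-- The affine minorant of the augmented Lagrangian given by the maximizer. -/
theorem inner_le_augLag_sub {σ : ℝ} (hσ : 0 < σ) {y y' : E m} {x p p' : E n}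
    (hp : IsProj P.K (x - σ • (P.c - P.Aadj y)) p)
    (hp' : IsProj P.K (x - σ • (P.c - P.Aadj y')) p') :
    inner ℝ (-P.b + P.Amap p) (y' - y) ≤ P.augLag σ y' x - P.augLag σ y x := by
  rw [P.augLag_eq hσ hp, P.augLag_eq hσ hp', ← P.proxLag_sub σ y y' x p]
  linarith [P.proxLag_le hσ hp' hp.1]

/-- The affine minorants at `y` and `y'` squeeze the remainder between `0` and the inner product of
the slope difference with `y' - y`. The slopes are Lipschitz because projections are nonexpansive,
so the remainder is quadratic. -/
theorem hasGradientAt_augLag (hK : P.K.Nonempty) {σ : ℝ} (hσ : 0 < σ) {y : E m} {x p : E n}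
    (hp : IsProj P.K (x - σ • (P.c - P.Aadj y)) p) :
    HasGradientAt (fun y => P.augLag σ y x) (-P.b + P.Amap p) y := by
  rw [hasGradientAt_iff_isLittleO]
  set A := LinearMap.toContinuousLinearMap P.Amap with hA
  set B := LinearMap.toContinuousLinearMap P.Aadj with hB
  have hbound : ∀ y', ‖P.augLag σ y' x - P.augLag σ y x - inner ℝ (-P.b + P.Amap p) (y' - y)‖ ≤
      ‖A‖ * (σ * ‖B‖) * ‖‖y' - y‖ ^ 2‖ := by
    intro y'
    obtain ⟨p', hp'⟩ := exists_isProj P.convex_K P.isClosed_K hK (x - σ • (P.c - P.Aadj y'))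
    have h1 := P.inner_le_augLag_sub hσ hp hp'
    have h2 := P.inner_le_augLag_sub hσ hp' hp
    have h3 : inner ℝ (-P.b + P.Amap p') (y - y') = -inner ℝ (-P.b + P.Amap p') (y' - y) := by
      rw [← inner_neg_right, neg_sub]
    have h4 : inner ℝ (-P.b + P.Amap p') (y' - y) - inner ℝ (-P.b + P.Amap p) (y' - y) =
        inner ℝ (A (p' - p)) (y' - y) := by
      rw [← inner_sub_left]
      congr 1
      simp [hA]
    have h5 : ‖p' - p‖ ≤ σ * ‖B‖ * ‖y' - y‖ := by
      refine (hp.norm_sub_le P.convex_K hp').trans ?_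
      rw [show x - σ • (P.c - P.Aadj y') - (x - σ • (P.c - P.Aadj y)) = σ • B (y' - y) by
        simp only [hB, LinearMap.coe_toContinuousLinearMap', map_sub, smul_sub]; abel, norm_smul,
        Real.norm_of_nonneg hσ.le, mul_assoc]
      exact mul_le_mul_of_nonneg_left (B.le_opNorm _) hσ.le
    have h6 : inner ℝ (A (p' - p)) (y' - y) ≤ ‖A‖ * (σ * ‖B‖) * ‖y' - y‖ ^ 2 :=
      calc inner ℝ (A (p' - p)) (y' - y) ≤ ‖A (p' - p)‖ * ‖y' - y‖ := real_inner_le_norm _ _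
        _ ≤ ‖A‖ * ‖p' - p‖ * ‖y' - y‖ := by gcongr; exact A.le_opNorm _
        _ ≤ ‖A‖ * (σ * ‖B‖ * ‖y' - y‖) * ‖y' - y‖ := by gcongr
        _ = _ := by ring
    rw [Real.norm_of_nonneg (by linarith), Real.norm_of_nonneg (by positivity)]
    linarith
  refine (Asymptotics.IsBigO.of_bound _ (Eventually.of_forall hbound)).trans_isLittleO ?_
  have h0 : Tendsto (fun y' : E m => y' - y) (𝓝 y) (𝓝 0) := by
    have : Continuous fun y' : E m => y' - y := by fun_prop
    simpa using this.tendsto y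
  exact (Asymptotics.isLittleO_norm_pow_id one_lt_two).comp_tendsto h0

theorem hasGradientAt_psi (hK : P.K.Nonempty) {σ τ : ℝ} (hσ : 0 < σ) {ybar y : E m}
    {xbar p : E n} (hp : IsProj P.K (xbar - σ • (P.c - P.Aadj y)) p) :
    HasGradientAt (P.psi σ τ ybar xbar) (-P.b + P.Amap p + (τ / σ) • (y - ybar)) y := by
  have h1 := (P.hasGradientAt_augLag hK hσ hp).hasFDerivAt
  have h2 : HasFDerivAt (fun y : E m => τ / (2 * σ) * ‖y - ybar‖ ^ 2) _ y :=
    ((((hasFDerivAt_id y).sub_const ybar).norm_sq).const_mul (τ / (2 * σ)))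
  rw [hasGradientAt_iff_hasFDerivAt]
  refine (h1.add h2).congr_fderiv ?_
  ext v
  simp
  field_simp

/-- Stationary points of the inner subproblem exist. -/
theorem exists_stationary (hK : P.K.Nonempty) {σ τ : ℝ} (hσ : 0 < σ) (hτ : 0 < τ) (ybar : E m)
    (xbar : E n) : ∃ (y : E m) (p : E n), IsProj P.K (xbar - σ • (P.c - P.Aadj y)) p ∧
      -P.b + P.Amap p + (τ / σ) • (y - ybar) = 0 := by
  have hproj : ∀ y, ∃ p, IsProj P.K (xbar - σ • (P.c - P.Aadj y)) p := fun y =>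
    exists_isProj P.convex_K P.isClosed_K hK _
  choose p hp using hproj
  have hgrad := fun y => P.hasGradientAt_psi hK (τ := τ) (ybar := ybar) hσ (hp y)
  have hcont : Continuous (P.psi σ τ ybar xbar) :=
    continuous_iff_continuousAt.2 fun y => (hgrad y).hasFDerivAt.continuousAt
  -- Coercivity: the augmented Lagrangian is above an affine function with slope `g`, which the
  -- quadratic term dominates far from `ybar`.
  obtain ⟨y, hy⟩ := hcont.exists_forall_le' ybar (by
    set g := -P.b + P.Amap (p ybar)
    have hev : ∀ᶠ y in cocompact (E m), ‖g‖ * (2 * σ / τ) + ‖ybar‖ ≤ ‖y‖ :=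
      tendsto_norm_cocompact_atTop.eventually_ge_atTop _
    filter_upwards [hev] with y hy
    have h1 := P.inner_le_augLag_sub hσ (hp ybar) (hp y)
    have h2 : -(‖g‖ * ‖y - ybar‖) ≤ inner ℝ g (y - ybar) :=
      (abs_le.1 (abs_real_inner_le_norm g (y - ybar))).1
    have h3 : ‖g‖ * (2 * σ / τ) ≤ ‖y - ybar‖ := by
      linarith [norm_sub_norm_le y ybar]
    have h4 : ‖g‖ ≤ τ / (2 * σ) * ‖y - ybar‖ := by
      have := mul_le_mul_of_nonneg_left h3 (show 0 ≤ τ / (2 * σ) by positivity)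
      calc ‖g‖ = τ / (2 * σ) * (‖g‖ * (2 * σ / τ)) := by field_simp
        _ ≤ _ := this
    have h5 := mul_le_mul_of_nonneg_right h4 (norm_nonneg (y - ybar))
    simp only [psi, sub_self, norm_zero]
    nlinarith)
  refine ⟨y, p y, hp y, ?_⟩
  have h0 : IsLocalMin (P.psi σ τ ybar xbar) y := Eventually.of_forall hy
  have h1 := h0.hasFDerivAt_eq_zero (hgrad y).hasFDerivAt
  exact (map_eq_zero_iff _ (InnerProductSpace.toDual ℝ (E m)).injective).1 h1

/-! ### The monotone operator -/

theorem mem_T_iff (hK : P.K.Nonempty) {z w : Z m n} : w ∈ P.T z ↔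
    w.fst = -P.b + P.Amap z.snd ∧ z.snd ∈ P.K ∧
      ∀ q ∈ P.K, inner ℝ (w.snd - (P.c - P.Aadj z.fst)) (q - z.snd) ≤ 0 := by
  constructor
  · rintro ⟨h1, v, hv, h2⟩
    have hz : z.snd ∈ P.K := by
      by_contra hz
      obtain ⟨q, hq⟩ := hK
      have := hv q
      simp [indicatorFn, hz, hq] at this
    refine ⟨h1, hz, fun q hq => ?_⟩
    have := hv q
    rw [h2, add_sub_cancel_left]
    simpa [indicatorFn, hz, hq] using this
  · rintro ⟨h1, hz, h⟩
    refine ⟨h1, w.snd - (P.c - P.Aadj z.fst), fun q => ?_, by abel⟩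
    by_cases hq : q ∈ P.K
    · simpa [indicatorFn, hz, hq] using h q hq
    · simp [indicatorFn, hq]

/-- The contributions of `A` and `Aᵀ` are skew and cancel; what remains is monotonicity of the
normal cone of the box. -/
theorem T_monotone (hK : P.K.Nonempty) {z w z' w' : Z m n} (h : w ∈ P.T z) (h' : w' ∈ P.T z') :
    0 ≤ inner ℝ (w - w') (z - z') := by
  obtain ⟨h1, hz, h2⟩ := (P.mem_T_iff hK).1 h
  obtain ⟨h1', hz', h2'⟩ := (P.mem_T_iff hK).1 h'
  have a := h2 _ hz'
  have a' := h2' _ hz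
  have e : inner ℝ (w.fst - w'.fst) (z.fst - z'.fst) =
      inner ℝ (z.snd - z'.snd) (P.Aadj (z.fst - z'.fst)) := by
    rw [P.inner_Aadj, h1, h1', map_sub]
    congr 1
    abel
  rw [WithLp.prod_inner_apply]
  change 0 ≤ inner ℝ (w.fst - w'.fst) (z.fst - z'.fst) + inner ℝ (w.snd - w'.snd) (z.snd - z'.snd)
  rw [e, real_inner_comm, ← inner_add_left]
  have e2 : inner ℝ (P.Aadj (z.fst - z'.fst) + (w.snd - w'.snd)) (z.snd - z'.snd) =
      -inner ℝ (w.snd - (P.c - P.Aadj z.fst)) (z'.snd - z.snd)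
      - inner ℝ (w'.snd - (P.c - P.Aadj z'.fst)) (z.snd - z'.snd) := by
    rw [← neg_sub z.snd z'.snd, inner_neg_right, neg_neg, ← inner_sub_left, map_sub]
    congr 1
    abel
  linarith

/-- The inexact iteration as a perturbed preconditioned proximal point step. -/
theorem mem_T_of_isProj (hK : P.K.Nonempty) {σ τ : ℝ} (hσ : 0 < σ) {y ybar : E m}
    {p xbar : E n} (hp : IsProj P.K (xbar - σ • (P.c - P.Aadj y)) p) :
    pair (-P.b + P.Amap p + (τ / σ) • (y - ybar)) 0
      + σ⁻¹ • Lam m n τ (pair ybar xbar - pair y p) ∈ P.T (pair y p) := by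
  rw [P.mem_T_iff hK]
  refine ⟨?_, hp.1, fun q hq => ?_⟩
  · simp [Lam, smul_smul]
    rw [show σ⁻¹ * τ = τ / σ by ring]
    module
  · have h := hp.inner_le P.convex_K hq
    have e : (pair (-P.b + P.Amap p + (τ / σ) • (y - ybar)) 0
        + σ⁻¹ • Lam m n τ (pair ybar xbar - pair y p)).snd - (P.c - P.Aadj y) =
        σ⁻¹ • (xbar - σ • (P.c - P.Aadj y) - p) := by
      simp [Lam, smul_sub, smul_smul, hσ.ne']
      abel
    change inner ℝ ((pair (-P.b + P.Amap p + (τ / σ) • (y - ybar)) 0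
        + σ⁻¹ • Lam m n τ (pair ybar xbar - pair y p)).snd - (P.c - P.Aadj y)) (q - p) ≤ 0
    rw [e, inner_smul_left]
    exact mul_nonpos_of_nonneg_of_nonpos (by simpa using hσ.le) h

/-- An exact minimizer of the subproblem, paired with its projection, is the resolvent point, so
maximality of `T` need not be invoked. -/
theorem exists_resolvent (hK : P.K.Nonempty) {σ τ : ℝ} (hσ : 0 < σ) (hτ : 0 < τ) (z : Z m n) :
    ∃ z', σ⁻¹ • Lam m n τ (z - z') ∈ P.T z' := by
  obtain ⟨y, p, hp, h0⟩ := P.exists_stationary hK hσ hτ z.fst z.snd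
  have h := P.mem_T_of_isProj hK (τ := τ) (ybar := z.fst) hσ hp
  rw [h0, show (pair (0 : E m) (0 : E n)) = 0 from rfl, zero_add] at h
  exact ⟨pair y p, h⟩

end LP

end Snipal

namespace Snipal

namespace LP

variable {m n : ℕ} (P : LP m n)

/-! ### The error bound for the KKT system -/

/-- The box is a product, so it suffices to test competitors that differ from `x` in one coordinate.
-/
theorem normal_K_iff {x v : E n} (hx : x ∈ P.K) :
    (∀ q ∈ P.K, inner ℝ v (q - x) ≤ 0) ↔
      ∀ i (t : ℝ), P.lo i ≤ t → (t : EReal) ≤ P.up i → v i * (t - x i) ≤ 0 := by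
  constructor
  · intro h i t h1 h2
    have := h (x + EuclideanSpace.single i (t - x i)) (fun j => by
      by_cases hj : j = i
      · subst hj
        simpa using ⟨h1, h2⟩
      · simpa [hj] using hx j)
    simpa [EuclideanSpace.inner_single_right, mul_comm] using this
  · intro h q hq
    rw [PiLp.inner_apply]
    refine Finset.sum_nonpos fun i _ => ?_
    have := h i (q i) (hq i).1 (hq i).2
    simpa [mul_comm] using this

theorem mem_kkt_iff (hK : P.K.Nonempty) {z : Z m n} : z ∈ P.kkt ↔
    P.Amap z.snd = P.b ∧ z.snd ∈ P.K ∧ ∀ i (t : ℝ), P.lo i ≤ t → (t : EReal) ≤ P.up i →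
      (P.Aadj z.fst i - P.c i) * (t - z.snd i) ≤ 0 := by
  rw [kkt, Set.mem_ofPred_eq, P.mem_T_iff hK]
  refine and_congr ?_ (and_congr_right fun hz => ?_)
  · rw [WithLp.zero_fst, eq_comm, neg_add_eq_zero, eq_comm]
  · rw [P.normal_K_iff hz]
    simp

/-- The linear functionals which describe the KKT system. -/
noncomputable def kktFunctional : Fin m ⊕ Fin n ⊕ Fin n → Z m n →ₗ[ℝ] ℝ
  | .inl j => { toFun := fun z => P.Amap z.snd j, map_add' := by simp, map_smul' := by simp }
  | .inr (.inl i) => { toFun := fun z => z.snd i, map_add' := by simp, map_smul' := by simp }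
  | .inr (.inr i) =>
    { toFun := fun z => P.Aadj z.fst i, map_add' := by simp, map_smul' := by simp }

/-- The lower bounds in the linear system of KKT points whose reduced costs have signs `s`. -/
noncomputable def kktLower (s : Fin n → SignType) : Fin m ⊕ Fin n ⊕ Fin n → EReal
  | .inl j => (P.b j : ℝ)
  | .inr (.inl i) => if s i = 1 then P.up i else P.lo i
  | .inr (.inr i) => if s i = -1 then ⊥ else ((P.c i : ℝ) : EReal)

/-- The upper bounds in the linear system of KKT points whose reduced costs have signs `s`. -/
noncomputable def kktUpper (s : Fin n → SignType) : Fin m ⊕ Fin n ⊕ Fin n → EReal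
  | .inl j => (P.b j : ℝ)
  | .inr (.inl i) => if s i = -1 then P.lo i else P.up i
  | .inr (.inr i) => if s i = 1 then ⊤ else ((P.c i : ℝ) : EReal)

/-- Sign `1` puts the coordinate at its upper bound with `Aᵀy - c ≥ 0`, sign `-1` at its lower bound
with `Aᵀy - c ≤ 0`, and sign `0` leaves it in the box with `Aᵀy = c` there. Each choice implies
complementarity. -/
theorem mem_kkt_of_bounds (hK : P.K.Nonempty) {s : Fin n → SignType} {z : Z m n}
    (h : ∀ i, P.kktLower s i ≤ (P.kktFunctional i z : EReal) ∧
      (P.kktFunctional i z : EReal) ≤ P.kktUpper s i) : z ∈ P.kkt := by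
  have hlu : ∀ i, P.lo i ≤ P.up i := by
    obtain ⟨q, hq⟩ := hK
    exact fun i => (hq i).1.trans (hq i).2
  have hz : z.snd ∈ P.K := fun i => by
    have h1 : (if s i = 1 then P.up i else P.lo i) ≤ (z.snd i : EReal) := (h (.inr (.inl i))).1
    have h2 : (z.snd i : EReal) ≤ if s i = -1 then P.lo i else P.up i := (h (.inr (.inl i))).2
    constructor
    · refine le_trans ?_ h1
      split_ifs
      exacts [hlu i, le_rfl]
    · refine le_trans h2 ?_
      split_ifs
      exacts [hlu i, le_rfl]
  rw [P.mem_kkt_iff hK]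
  refine ⟨?_, hz, fun i t h1 h2 => ?_⟩
  · ext j
    exact le_antisymm (EReal.coe_le_coe_iff.1 (h (.inl j)).2) (EReal.coe_le_coe_iff.1 (h (.inl j)).1)
  · have a1 : (if s i = 1 then P.up i else P.lo i) ≤ (z.snd i : EReal) := (h (.inr (.inl i))).1
    have a2 : (z.snd i : EReal) ≤ if s i = -1 then P.lo i else P.up i := (h (.inr (.inl i))).2
    have a3 : (if s i = -1 then ⊥ else ((P.c i : ℝ) : EReal)) ≤ (P.Aadj z.fst i : ℝ) :=
      (h (.inr (.inr i))).1
    have a4 : ((P.Aadj z.fst i : ℝ) : EReal) ≤ if s i = 1 then ⊤ else ((P.c i : ℝ) : EReal) :=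
      (h (.inr (.inr i))).2
    rcases hs : s i with _ | _ | _
    · simp only [hs, SignType.zero_eq_zero, zero_ne_one, if_false,
        show (0 : SignType) ≠ -1 by decide, EReal.coe_le_coe_iff] at a3 a4
      rw [le_antisymm a4 a3, sub_self, zero_mul]
    · simp only [hs, SignType.neg_eq_neg_one, if_true, show (-1 : SignType) ≠ 1 by decide,
        if_false, EReal.coe_le_coe_iff] at a2 a4
      have := EReal.coe_le_coe_iff.1 (a2.trans h1)
      exact mul_nonpos_of_nonpos_of_nonneg (by linarith) (by linarith)
    · simp only [hs, SignType.pos_eq_one, if_true, show (1 : SignType) ≠ -1 by decide,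
        if_false, EReal.coe_le_coe_iff] at a1 a3
      have := EReal.coe_le_coe_iff.1 (h2.trans a1)
      exact mul_nonpos_of_nonneg_of_nonpos (by linarith) (by linarith)

theorem bounds_of_mem_T (hK : P.K.Nonempty) {z w : Z m n} (h : w ∈ P.T z) :
    ∃ s : Fin n → SignType, ∀ i,
      P.kktLower s i ≤ ((P.kktFunctional i z + ‖w‖ : ℝ) : EReal) ∧
      ((P.kktFunctional i z - ‖w‖ : ℝ) : EReal) ≤ P.kktUpper s i := by
  obtain ⟨h1, hz, h2⟩ := (P.mem_T_iff hK).1 h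
  rw [P.normal_K_iff hz] at h2
  have hw1 : ∀ j, |w.fst j| ≤ ‖w‖ := fun j => (PiLp.norm_apply_le w.fst j).trans
    (WithLp.norm_fst_le _ w)
  have hw2 : ∀ j, |w.snd j| ≤ ‖w‖ := fun j => (PiLp.norm_apply_le w.snd j).trans
    (WithLp.norm_snd_le _ w)
  have h0 := norm_nonneg w
  have hx : ∀ i, ((z.snd i - ‖w‖ : ℝ) : EReal) ≤ (z.snd i : ℝ) ∧
      ((z.snd i : ℝ) : EReal) ≤ ((z.snd i + ‖w‖ : ℝ) : EReal) := fun i =>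
    ⟨EReal.coe_le_coe_iff.2 (by linarith), EReal.coe_le_coe_iff.2 (by linarith)⟩
  -- The signs are those of the exact normal vector: where it is nonzero, `x` sits exactly at a
  -- bound, and the reduced cost differs from it only by a component of `w`.
  refine ⟨fun i => SignType.sign ((w.snd - (P.c - P.Aadj z.fst)) i), ?_⟩
  rintro (j | i | i)
  · have e : w.fst j = -P.b j + P.Amap z.snd j := by rw [h1]; rfl
    have := abs_le.1 (hw1 j)
    change ((P.b j : ℝ) : EReal) ≤ ((P.Amap z.snd j + ‖w‖ : ℝ) : EReal) ∧
      ((P.Amap z.snd j - ‖w‖ : ℝ) : EReal) ≤ ((P.b j : ℝ) : EReal)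
    rw [EReal.coe_le_coe_iff, EReal.coe_le_coe_iff]
    constructor <;> linarith
  · change (if _ = 1 then P.up i else P.lo i) ≤ ((z.snd i + ‖w‖ : ℝ) : EReal) ∧
      ((z.snd i - ‖w‖ : ℝ) : EReal) ≤ if _ = -1 then P.lo i else P.up i
    constructor
    · refine le_trans ?_ (hx i).2
      split_ifs with hs
      · rw [sign_eq_one_iff] at hs
        by_contra hlt
        push Not at hlt
        obtain ⟨t, ht1, ht2⟩ := EReal.lt_iff_exists_real_btwn.1 hlt
        have := h2 i t ((hz i).1.trans ht1.le) ht2.le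
        rw [EReal.coe_lt_coe_iff] at ht1
        nlinarith
      · exact (hz i).1
    · refine le_trans (hx i).1 ?_
      split_ifs with hs
      · rw [sign_eq_neg_one_iff] at hs
        by_contra hlt
        push Not at hlt
        obtain ⟨t, ht1, ht2⟩ := EReal.lt_iff_exists_real_btwn.1 hlt
        have := h2 i t ht1.le (ht2.le.trans (hz i).2)
        rw [EReal.coe_lt_coe_iff] at ht2
        nlinarith
      · exact (hz i).2
  · change (if _ = -1 then ⊥ else ((P.c i : ℝ) : EReal)) ≤
      ((P.Aadj z.fst i + ‖w‖ : ℝ) : EReal) ∧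
      ((P.Aadj z.fst i - ‖w‖ : ℝ) : EReal) ≤ if _ = 1 then ⊤ else ((P.c i : ℝ) : EReal)
    have e : (w.snd - (P.c - P.Aadj z.fst)) i = w.snd i - P.c i + P.Aadj z.fst i := by
      simp
      ring
    have := abs_le.1 (hw2 i)
    constructor
    · split_ifs with hs
      · exact bot_le
      · rw [sign_eq_neg_one_iff, not_lt, e] at hs
        rw [EReal.coe_le_coe_iff]
        linarith
    · split_ifs with hs
      · exact le_top
      · rw [sign_eq_one_iff, not_lt, e] at hs
        rw [EReal.coe_le_coe_iff]
        linarith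

theorem exists_local_errorBound (hK : P.K.Nonempty) :
    ∃ κ > 0, ∃ η > 0, ∀ z w : Z m n, w ∈ P.T z → ‖w‖ < η →
      ∃ z' ∈ P.kkt, ‖z' - z‖ ≤ κ * ‖w‖ := by
  choose κ hκ η hη H using fun s => exists_hoffman P.kktFunctional (P.kktLower s) (P.kktUpper s)
  obtain ⟨s1, h1⟩ := Finite.exists_max κ
  obtain ⟨s2, h2⟩ := Finite.exists_min η
  refine ⟨κ s1, hκ s1, η s2, hη s2, fun z w hw hlt => ?_⟩
  obtain ⟨s, hs⟩ := P.bounds_of_mem_T hK hw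
  obtain ⟨z', hz', hle⟩ := H s ‖w‖ z (norm_nonneg w) (hlt.trans_le (h2 s)) hs
  exact ⟨z', P.mem_kkt_of_bounds hK hz',
    hle.trans (mul_le_mul_of_nonneg_right (h1 s) (norm_nonneg w))⟩

theorem exists_errorBound (hK : P.K.Nonempty) (r : ℝ) : ∃ κ : ℝ, 0 < κ ∧ P.ErrorBound r κ := by
  obtain ⟨κ, hκ, η, hη, H⟩ := P.exists_local_errorBound hK
  have hpos : 0 < max κ (r / η) := lt_max_of_lt_left hκ
  -- `κ` serves residuals below `η`; for larger ones `dist ≤ r ≤ (r / η) ‖w‖` is immediate.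
  refine ⟨max κ (r / η), hpos, fun z hz => ?_⟩
  change _ ≤ _ * ⨅ w ∈ P.T z, edist 0 w
  rw [ENNReal.mul_iInf_of_ne (ENNReal.ofReal_pos.2 hpos).ne' ENNReal.ofReal_ne_top]
  refine le_iInf fun w => ?_
  rw [ENNReal.mul_iInf_of_ne (ENNReal.ofReal_pos.2 hpos).ne' ENNReal.ofReal_ne_top]
  refine le_iInf fun hw => ?_
  rw [edist_dist, dist_zero_left, ← ENNReal.ofReal_mul hpos.le]
  rcases lt_or_ge ‖w‖ η with hlt | hge
  · obtain ⟨z', hz', hle⟩ := H z w hw hlt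
    refine (Metric.infEDist_le_edist_of_mem hz').trans ?_
    rw [edist_dist, dist_comm, dist_eq_norm]
    exact ENNReal.ofReal_le_ofReal (hle.trans
      (mul_le_mul_of_nonneg_right (le_max_left _ _) (norm_nonneg w)))
  · refine hz.trans (ENNReal.ofReal_le_ofReal ?_)
    rcases le_or_gt r 0 with hr | hr
    · exact hr.trans (by positivity)
    · calc r = r / η * η := by field_simp
        _ ≤ max κ (r / η) * ‖w‖ := mul_le_mul (le_max_right _ _) hge hη.le hpos.le

end LP

end Snipal

namespace Snipal

/-! ### The weighted norm -/

/-- Splitting `Λ` into two self-adjoint square roots turns the weighted norm into the ordinary norm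
of `Lam m n √t z`. -/
theorem inner_Lam {m n : ℕ} {t : ℝ} (ht : 0 ≤ t) (a b : Z m n) :
    inner ℝ (Lam m n t a) b = inner ℝ (Lam m n √t a) (Lam m n √t b) := by
  rw [WithLp.prod_inner_apply, WithLp.prod_inner_apply]
  simp only [Lam, LinearMap.coe_mk, AddHom.coe_mk, inner_smul_left, inner_smul_right,
    ← mul_assoc]
  simp [Real.mul_self_sqrt ht]

theorem wnorm_Lam {m n : ℕ} {t : ℝ} (ht : 0 ≤ t) (z : Z m n) :
    wnorm (Lam m n t) z = ‖Lam m n √t z‖ := by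
  rw [wnorm, real_inner_comm, inner_Lam ht, real_inner_self_eq_norm_sq,
    Real.sqrt_sq (norm_nonneg _)]

theorem norm_Lam_sq {m n : ℕ} (t : ℝ) (z : Z m n) :
    ‖Lam m n t z‖ ^ 2 = t ^ 2 * ‖z.fst‖ ^ 2 + ‖z.snd‖ ^ 2 := by
  rw [WithLp.prod_norm_sq_eq_of_L2]
  simp [Lam, norm_smul, mul_pow]

theorem norm_Lam_mono {m n : ℕ} {s t : ℝ} (hs : 0 ≤ s) (hst : s ≤ t) (z : Z m n) :
    ‖Lam m n s z‖ ≤ ‖Lam m n t z‖ := by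
  rw [← sq_le_sq₀ (norm_nonneg _) (norm_nonneg _), norm_Lam_sq, norm_Lam_sq]
  gcongr

theorem Lam_one {m n : ℕ} (z : Z m n) : Lam m n 1 z = z := by
  simp only [Lam, LinearMap.coe_mk, AddHom.coe_mk, one_smul]
  rfl

theorem norm_fst_le_norm_Lam {m n : ℕ} {t : ℝ} (ht : 0 ≤ t) (z : Z m n) :
    t * ‖z.fst‖ ≤ ‖Lam m n t z‖ := by
  rw [← sq_le_sq₀ (by positivity) (norm_nonneg _), norm_Lam_sq, mul_pow]
  linarith [sq_nonneg ‖z.snd‖]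

theorem norm_Lam_le {m n : ℕ} {t : ℝ} (ht : 0 ≤ t) (z : Z m n) :
    ‖Lam m n √t z‖ ≤ √(max t 1) * ‖z‖ := by
  rw [← sq_le_sq₀ (norm_nonneg _) (by positivity), norm_Lam_sq, mul_pow, Real.sq_sqrt ht,
    Real.sq_sqrt (by positivity), WithLp.prod_norm_sq_eq_of_L2, mul_add]
  have h1 := le_max_left t 1
  have h2 := le_max_right t 1
  nlinarith [mul_le_mul_of_nonneg_right h1 (sq_nonneg ‖z.fst‖),
    mul_le_mul_of_nonneg_right h2 (sq_nonneg ‖z.snd‖)]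

theorem norm_Lam_le_norm_Lam_sqrt {m n : ℕ} {t : ℝ} (ht : 0 ≤ t) (z : Z m n) :
    ‖Lam m n t z‖ ≤ √(max t 1) * ‖Lam m n √t z‖ := by
  rw [← sq_le_sq₀ (norm_nonneg _) (by positivity), norm_Lam_sq, mul_pow, norm_Lam_sq,
    Real.sq_sqrt ht, Real.sq_sqrt (by positivity), mul_add]
  have h1 := le_max_left t 1
  have h2 := le_max_right t 1
  nlinarith [mul_le_mul_of_nonneg_right h1 (show 0 ≤ t * ‖z.fst‖ ^ 2 by positivity),
    mul_le_mul_of_nonneg_right h2 (sq_nonneg ‖z.snd‖)]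

theorem norm_le_norm_Lam {m n : ℕ} {t : ℝ} (ht : 0 < t) (z : Z m n) :
    ‖z‖ ≤ ‖Lam m n √t z‖ / √(min 1 t) := by
  have h0 : 0 < min 1 t := lt_min one_pos ht
  rw [le_div_iff₀ (Real.sqrt_pos.2 h0), ← sq_le_sq₀ (by positivity) (norm_nonneg _), norm_Lam_sq,
    mul_pow, Real.sq_sqrt ht.le, Real.sq_sqrt h0.le, WithLp.prod_norm_sq_eq_of_L2, add_mul]
  have h1 := min_le_left 1 t
  have h2 := min_le_right 1 t
  nlinarith [mul_le_mul_of_nonneg_right h1 (sq_nonneg ‖z.snd‖),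
    mul_le_mul_of_nonneg_right h2 (sq_nonneg ‖z.fst‖)]

namespace LP

variable {m n : ℕ} (P : LP m n)

/-! ### The residual away from the solution set -/

theorem ErrorBound.infDist_le {r κ : ℝ} (h : P.ErrorBound r κ) (hκ : 0 ≤ κ)
    (hne : P.kkt.Nonempty) {z w : Z m n} (hz : Metric.infDist z P.kkt ≤ r) (hw : w ∈ P.T z) :
    Metric.infDist z P.kkt ≤ κ * ‖w‖ := by
  have h1 := h z (by
    rw [← ENNReal.ofReal_toReal (Metric.infEDist_ne_top hne)]
    exact ENNReal.ofReal_le_ofReal hz)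
  have h2 : Metric.infEDist 0 (P.T z) ≤ ENNReal.ofReal ‖w‖ := by
    refine (Metric.infEDist_le_edist_of_mem hw).trans ?_
    rw [edist_dist, dist_zero_left]
  refine ENNReal.toReal_le_of_le_ofReal (by positivity) (h1.trans ?_)
  rw [ENNReal.ofReal_mul hκ]
  gcongr

/-- Makes the path `l ↦ (I + l T)⁻¹ z` continuous in the step length. With `v = k⁻¹ (z - b)`,
monotonicity reads `‖a - b‖² ≤ (k - l) ⟨v, a - b⟩`. -/
theorem resolvent_lipschitz (hK : P.K.Nonempty) {l k : ℝ} (hl : 0 < l) (hk : 0 < k)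
    {z a b : Z m n} (ha : l⁻¹ • (z - a) ∈ P.T a) (hb : k⁻¹ • (z - b) ∈ P.T b) :
    ‖a - b‖ ≤ |k - l| * ‖k⁻¹ • (z - b)‖ := by
  have h := P.T_monotone hK ha hb
  have e : inner ℝ (l⁻¹ • (z - a) - k⁻¹ • (z - b)) (a - b) =
      l⁻¹ * ((k - l) * inner ℝ (k⁻¹ • (z - b)) (a - b) - ‖a - b‖ ^ 2) := by
    have hv : z - a = k • (k⁻¹ • (z - b)) - (a - b) := by
      rw [smul_smul, mul_inv_cancel₀ hk.ne', one_smul]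
      abel
    have hv' : l⁻¹ • (z - a) - k⁻¹ • (z - b) = l⁻¹ • ((k - l) • (k⁻¹ • (z - b)) - (a - b)) := by
      rw [hv]
      generalize k⁻¹ • (z - b) = v
      have hlv : l⁻¹ • l • v = v := by rw [smul_smul, inv_mul_cancel₀ hl.ne', one_smul]
      simp only [sub_smul, smul_sub, hlv]
      abel
    rw [hv', inner_smul_left, inner_sub_left, inner_smul_left, real_inner_self_eq_norm_sq]
    simp
  rw [e] at h
  have h1 : ‖a - b‖ ^ 2 ≤ (k - l) * inner ℝ (k⁻¹ • (z - b)) (a - b) := by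
    have := nonneg_of_mul_nonneg_right h (inv_pos.2 hl)
    linarith
  have h2 : (k - l) * inner ℝ (k⁻¹ • (z - b)) (a - b) ≤
      |k - l| * (‖k⁻¹ • (z - b)‖ * ‖a - b‖) := by
    refine (le_abs_self _).trans ?_
    rw [abs_mul]
    exact mul_le_mul_of_nonneg_left (abs_real_inner_le_norm _ _) (abs_nonneg _)
  by_contra hlt
  push Not at hlt
  have h3 : 0 ≤ |k - l| * ‖k⁻¹ • (z - b)‖ := by positivity
  nlinarith

theorem resolvent_residual_le (hK : P.K.Nonempty) {l : ℝ} (hl : 0 < l)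
    {z w a : Z m n} (ha : l⁻¹ • (z - a) ∈ P.T a) (hw : w ∈ P.T z) :
    ‖l⁻¹ • (z - a)‖ ≤ ‖w‖ := by
  have h := P.T_monotone hK hw ha
  set v := l⁻¹ • (z - a) with hv
  have e : z - a = l • v := by rw [hv, smul_smul, mul_inv_cancel₀ hl.ne', one_smul]
  rw [e, inner_smul_right] at h
  have h1 := nonneg_of_mul_nonneg_right h hl
  rw [inner_sub_left, real_inner_self_eq_norm_sq] at h1
  have h2 := real_inner_le_norm w v
  by_contra hlt
  push Not at hlt
  nlinarith [norm_nonneg w]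

/-- In the weighted norm, expand `z - u = (z - a) + (a - u)`; the cross term is nonnegative by
monotonicity, as `0` belongs to `T u`. -/
theorem resolvent_sq_le (hK : P.K.Nonempty) {l t : ℝ} (hl : 0 < l) (ht : 0 ≤ t)
    {z a u : Z m n} (ha : l⁻¹ • Lam m n t (z - a) ∈ P.T a) (hu : u ∈ P.kkt) :
    ‖Lam m n √t (a - u)‖ ^ 2 + ‖Lam m n √t (z - a)‖ ^ 2 ≤ ‖Lam m n √t (z - u)‖ ^ 2 := by
  have h := P.T_monotone hK ha hu
  rw [sub_zero, inner_smul_left, inner_Lam ht] at h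
  have h1 := nonneg_of_mul_nonneg_right h (by simpa using hl)
  rw [show z - u = (z - a) + (a - u) by abel, map_add (Lam m n √t) (z - a), norm_add_sq_real]
  linarith

/-- An error bound on the neighbourhood of radius `r` of the solution set forces the residual to
be at least `r / κ` outside of this neighbourhood. -/
theorem ErrorBound.min_infDist_le {r κ : ℝ} (h : P.ErrorBound r κ) (hK : P.K.Nonempty)
    (hr : 0 < r) (hκ : 0 ≤ κ) (hne : P.kkt.Nonempty) {z w : Z m n} (hw : w ∈ P.T z) :
    min (Metric.infDist z P.kkt) r ≤ κ * ‖w‖ := by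
  rcases le_or_gt (Metric.infDist z P.kkt) r with hz | hz
  · exact (min_le_left _ _).trans (h.infDist_le P hκ hne hz hw)
  refine (min_le_right _ _).trans ?_
  have hex : ∀ l : Set.Ioi (0 : ℝ), ∃ a, (l : ℝ)⁻¹ • (z - a) ∈ P.T a := fun l => by
    obtain ⟨a, ha⟩ := P.exists_resolvent hK l.2 one_pos z
    exact ⟨a, by rwa [Lam_one] at ha⟩
  choose J hJ using hex
  set f : Set.Ioi (0 : ℝ) → ℝ := fun l => Metric.infDist (J l) P.kkt with hf
  have hJlip : LipschitzWith ⟨‖w‖, norm_nonneg w⟩ J := by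
    refine LipschitzWith.of_dist_le_mul fun l k => ?_
    rw [dist_eq_norm, Subtype.dist_eq, Real.dist_eq, abs_sub_comm, mul_comm]
    exact (P.resolvent_lipschitz hK l.2 k.2 (hJ l) (hJ k)).trans
      (mul_le_mul_of_nonneg_left (P.resolvent_residual_le hK k.2 (hJ k) hw) (abs_nonneg _))
  have hfc : Continuous f := (Metric.continuous_infDist_pt _).comp hJlip.continuous
  obtain ⟨u, hu⟩ := hne
  have hsq : ∀ l : Set.Ioi (0 : ℝ), ∀ v ∈ P.kkt,
      ‖J l - v‖ ^ 2 + ‖z - J l‖ ^ 2 ≤ ‖z - v‖ ^ 2 := fun l v hv => by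
    have := P.resolvent_sq_le hK (t := 1) l.2 zero_le_one (by rw [Lam_one]; exact hJ l) hv
    simpa only [Real.sqrt_one, Lam_one] using this
  -- An auxiliary constant valid up to radius `‖z - u‖`, used only to show that the path enters the
  -- `r`-neighbourhood; the conclusion keeps `κ`.
  obtain ⟨κ', hκ', hE⟩ := P.exists_errorBound hK ‖z - u‖
  have hw0 := norm_nonneg w
  -- A step so short that the path moves at most `dist z - r`, since it moves at most `l ‖w‖`.
  let l1 : Set.Ioi (0 : ℝ) :=
    ⟨(Metric.infDist z P.kkt - r) / (‖w‖ + 1),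
      Set.mem_Ioi.2 (div_pos (sub_pos.2 hz) (by positivity))⟩
  -- A step so long that the residual, at most `‖z - u‖ / l`, forces distance at most `r` through
  -- `κ'`.
  let l2 : Set.Ioi (0 : ℝ) := ⟨κ' * (‖z - u‖ + 1) / r, Set.mem_Ioi.2 (by positivity)⟩
  have hf1 : r ≤ f l1 := by
    have h1 : Metric.infDist z P.kkt ≤ f l1 + dist z (J l1) := Metric.infDist_le_infDist_add_dist
    have h2 := P.resolvent_residual_le hK l1.2 (hJ l1) hw
    have h0 : (0 : ℝ) < l1 := l1.2
    rw [norm_smul, Real.norm_of_nonneg (inv_nonneg.2 h0.le), inv_mul_le_iff₀ h0] at h2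
    have h3 : (l1 : ℝ) * (‖w‖ + 1) = Metric.infDist z P.kkt - r :=
      div_mul_cancel₀ _ (by positivity)
    rw [dist_eq_norm] at h1
    linarith
  have hf2 : f l2 ≤ r := by
    have h0 : (0 : ℝ) < l2 := l2.2
    have h1 := hsq l2 u hu
    have h2 : ‖J l2 - u‖ ≤ ‖z - u‖ := by
      rw [← sq_le_sq₀ (norm_nonneg _) (norm_nonneg _)]
      linarith [sq_nonneg ‖z - J l2‖]
    have h3 : ‖z - J l2‖ ≤ ‖z - u‖ := by
      rw [← sq_le_sq₀ (norm_nonneg _) (norm_nonneg _)]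
      linarith [sq_nonneg ‖J l2 - u‖]
    have h4 := hE.infDist_le P hκ'.le ⟨u, hu⟩
      ((Metric.infDist_le_dist_of_mem hu).trans (by rwa [dist_eq_norm])) (hJ l2)
    refine h4.trans ?_
    rw [norm_smul, Real.norm_of_nonneg (inv_nonneg.2 h0.le)]
    calc κ' * ((l2 : ℝ)⁻¹ * ‖z - J l2‖) ≤ κ' * ((l2 : ℝ)⁻¹ * (‖z - u‖ + 1)) := by
          gcongr; linarith
      _ = r := by simp only [l2]; field_simp
  have hpre : PreconnectedSpace (Set.Ioi (0 : ℝ)) :=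
    Subtype.preconnectedSpace isPreconnected_Ioi
  -- At a point of the path at distance exactly `r` the given error bound applies, and the residual
  -- there is at most `‖w‖`.
  obtain ⟨l, hl⟩ := mem_range_of_exists_le_of_exists_ge hfc ⟨l2, hf2⟩ ⟨l1, hf1⟩
  have h5 := h.infDist_le P hκ ⟨u, hu⟩ hl.le (hJ l)
  calc r = f l := hl.symm
    _ ≤ κ * ‖(l : ℝ)⁻¹ • (z - J l)‖ := h5
    _ ≤ κ * ‖w‖ := by gcongr; exact P.resolvent_residual_le hK l.2 (hJ l) hw

end LP

end Snipal

namespace Snipal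

/-! ### The weighted distance to the solution set -/

/-- The distance `dist_Λ(z, D)` for `Λ = Diag(t I, I)`, as a real number. -/
noncomputable def lamDist {m n : ℕ} (t : ℝ) (z : Z m n) (D : Set (Z m n)) : ℝ :=
  ⨅ w : D, ‖Lam m n √t (z - w)‖

theorem lamDist_le {m n : ℕ} (t : ℝ) (z : Z m n) {D : Set (Z m n)} {w : Z m n} (hw : w ∈ D) :
    lamDist t z D ≤ ‖Lam m n √t (z - w)‖ :=
  ciInf_le ⟨0, Set.forall_mem_range.2 fun _ => norm_nonneg _⟩ (⟨w, hw⟩ : D)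

theorem le_lamDist {m n : ℕ} {t a : ℝ} {z : Z m n} {D : Set (Z m n)} (hD : D.Nonempty)
    (h : ∀ w ∈ D, a ≤ ‖Lam m n √t (z - w)‖) : a ≤ lamDist t z D := by
  have := hD.to_subtype
  exact le_ciInf fun w => h w w.2

theorem lamDist_nonneg {m n : ℕ} (t : ℝ) (z : Z m n) (D : Set (Z m n)) : 0 ≤ lamDist t z D :=
  Real.iInf_nonneg fun _ => norm_nonneg _

theorem wdist_Lam {m n : ℕ} {t : ℝ} (ht : 0 ≤ t) (z : Z m n) {D : Set (Z m n)}
    (hD : D.Nonempty) : wdist (Lam m n t) z D = ENNReal.ofReal (lamDist t z D) := by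
  have hfin : wdist (Lam m n t) z D ≠ ⊤ := by
    obtain ⟨w, hw⟩ := hD
    exact ne_top_of_le_ne_top ENNReal.ofReal_ne_top (iInf₂_le w hw)
  refine le_antisymm ?_ (le_iInf₂ fun w hw => ?_)
  · rw [← ENNReal.ofReal_toReal hfin]
    refine ENNReal.ofReal_le_ofReal (le_lamDist hD fun w hw => ?_)
    rw [← wnorm_Lam ht]
    exact ENNReal.toReal_le_of_le_ofReal (Real.sqrt_nonneg _) (iInf₂_le w hw)
  · rw [wnorm_Lam ht]
    exact ENNReal.ofReal_le_ofReal (lamDist_le t z hw)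

theorem lamDist_le_add {m n : ℕ} (t : ℝ) (z z' : Z m n) {D : Set (Z m n)} (hD : D.Nonempty) :
    lamDist t z D ≤ ‖Lam m n √t (z - z')‖ + lamDist t z' D := by
  rw [← sub_le_iff_le_add']
  refine le_lamDist hD fun w hw => ?_
  rw [sub_le_iff_le_add']
  refine (lamDist_le t z hw).trans ?_
  rw [← sub_add_sub_cancel z z' w, map_add]
  exact norm_add_le _ _

theorem lamDist_mono {m n : ℕ} {s t : ℝ} (hst : s ≤ t) (z : Z m n) {D : Set (Z m n)}
    (hD : D.Nonempty) : lamDist s z D ≤ lamDist t z D :=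
  le_lamDist hD fun _ hw => (lamDist_le s z hw).trans
    (norm_Lam_mono (Real.sqrt_nonneg _) (Real.sqrt_le_sqrt hst) _)

theorem infDist_le_lamDist {m n : ℕ} {t : ℝ} (ht : 0 < t) (z : Z m n) {D : Set (Z m n)}
    (hD : D.Nonempty) : Metric.infDist z D ≤ lamDist t z D / √(min 1 t) := by
  have h0 : 0 < √(min 1 t) := Real.sqrt_pos.2 (lt_min one_pos ht)
  rw [le_div_iff₀ h0]
  refine le_lamDist hD fun w hw => ?_
  rw [← le_div_iff₀ h0]
  refine (Metric.infDist_le_dist_of_mem hw).trans ?_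
  rw [dist_eq_norm]
  exact norm_le_norm_Lam ht _

theorem lamDist_le_infDist {m n : ℕ} {t : ℝ} (ht : 0 ≤ t) (z : Z m n) {D : Set (Z m n)}
    (hD : D.Nonempty) : lamDist t z D ≤ √(max t 1) * Metric.infDist z D := by
  have h0 : 0 < √(max t 1) := Real.sqrt_pos.2 (by positivity)
  rw [mul_comm, ← div_le_iff₀ h0, Metric.le_infDist hD]
  intro w hw
  rw [div_le_iff₀ h0, dist_eq_norm, mul_comm]
  exact (lamDist_le t z hw).trans (norm_Lam_le ht _)

namespace LP

variable {m n : ℕ} (P : LP m n)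

/-! ### One step of the method -/

/-- One exact preconditioned proximal point step. -/
theorem lamDist_resolvent_le {r κ σ t : ℝ} (hE : P.ErrorBound r κ) (hK : P.K.Nonempty)
    (hr : 0 < r) (hκ : 0 < κ) (hσ : 0 < σ) (ht : 0 < t) (hne : P.kkt.Nonempty) {z a : Z m n}
    (ha : σ⁻¹ • Lam m n t (z - a) ∈ P.T a) (hz : lamDist t z P.kkt ≤ r) :
    lamDist t a P.kkt ≤
      κ * max t 1 / √(σ ^ 2 + κ ^ 2 * max t 1 ^ 2) * lamDist t z P.kkt ∧
    lamDist t a P.kkt ≤ lamDist t z P.kkt ∧ ‖Lam m n √t (z - a)‖ ≤ lamDist t z P.kkt := by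
  set D := lamDist t z P.kkt
  set d := lamDist t a P.kkt
  set N := ‖Lam m n √t (z - a)‖
  set γ := max t 1
  have hγ1 : 1 ≤ γ := le_max_right _ _
  have hγ : 0 < γ := by positivity
  have hD0 : 0 ≤ D := lamDist_nonneg _ _ _
  have hd0 : 0 ≤ d := lamDist_nonneg _ _ _
  have hN0 : 0 ≤ N := norm_nonneg _
  have hsq : d ^ 2 + N ^ 2 ≤ D ^ 2 := by
    have : √(d ^ 2 + N ^ 2) ≤ D := le_lamDist hne fun w hw => by
      rw [Real.sqrt_le_left (norm_nonneg _)]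
      refine le_trans ?_ (P.resolvent_sq_le hK hσ ht.le ha hw)
      gcongr
      exact lamDist_le t a hw
    exact (Real.sqrt_le_left hD0).1 this
  have hdD : d ≤ D := by
    rw [← sq_le_sq₀ hd0 hD0]; linarith [sq_nonneg N]
  have hND : N ≤ D := by
    rw [← sq_le_sq₀ hN0 hD0]; linarith [sq_nonneg d]
  refine ⟨?_, hdD, hND⟩
  have hmin := hE.min_infDist_le P hK hr hκ.le hne ha
  have hres : ‖σ⁻¹ • Lam m n t (z - a)‖ ≤ σ⁻¹ * (√γ * N) := by
    rw [norm_smul, Real.norm_of_nonneg (inv_nonneg.2 hσ.le)]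
    gcongr
    exact norm_Lam_le_norm_Lam_sqrt ht.le _
  -- Truncating at `r` costs nothing, because `d ≤ D ≤ r ≤ √γ r`; the second `√γ`, from `hres`,
  -- completes the factor `γ`.
  have h1 : d ≤ √γ * min (Metric.infDist a P.kkt) r := by
    rw [mul_min_of_nonneg _ _ (Real.sqrt_nonneg _)]
    refine le_min (lamDist_le_infDist ht.le a hne) ((hdD.trans hz).trans ?_)
    exact le_mul_of_one_le_left hr.le (Real.one_le_sqrt.2 hγ1)
  have h2 : σ * d ≤ κ * γ * N := by
    have : d ≤ √γ * (κ * (σ⁻¹ * (√γ * N))) := by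
      refine h1.trans (mul_le_mul_of_nonneg_left (hmin.trans ?_) (Real.sqrt_nonneg _))
      exact mul_le_mul_of_nonneg_left hres hκ.le
    calc σ * d ≤ σ * (√γ * (κ * (σ⁻¹ * (√γ * N)))) := by gcongr
      _ = κ * (√γ * √γ) * N := by field_simp
      _ = κ * γ * N := by rw [Real.mul_self_sqrt hγ.le]
  have hS : 0 < σ ^ 2 + κ ^ 2 * γ ^ 2 := by positivity
  rw [div_mul_eq_mul_div, le_div_iff₀ (Real.sqrt_pos.2 hS),
    ← sq_le_sq₀ (by positivity) (by positivity), mul_pow, Real.sq_sqrt hS.le]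
  have h3 : (σ * d) ^ 2 ≤ (κ * γ * N) ^ 2 := by gcongr
  -- Adding `(κγd)²` to `h3` and using `h4` gives `(σ² + κ²γ²) d² ≤ (κγ)² D²`.
  have h4 := mul_le_mul_of_nonneg_left hsq (show 0 ≤ (κ * γ) ^ 2 by positivity)
  nlinarith

/-- The distance of an inexact step from the exact one is controlled by the gradient of the
subproblem. -/
theorem norm_Lam_sub_resolvent_le (hK : P.K.Nonempty) {σ t B : ℝ} (hσ : 0 < σ) (ht : 0 < t)
    {y ybar : E m} {x xbar : E n} {a : Z m n}
    (ha : σ⁻¹ • Lam m n t (pair ybar xbar - a) ∈ P.T a)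
    (hx : IsProj P.K (xbar - σ • (P.c - P.Aadj y)) x)
    (hB : ‖gradient (P.psi σ t ybar xbar) y‖ ≤ min √t 1 / σ * B) :
    ‖Lam m n √t (pair y x - a)‖ ≤ B := by
  rw [(P.hasGradientAt_psi hK hσ hx).gradient] at hB
  have hT := P.mem_T_of_isProj hK (τ := t) (ybar := ybar) hσ hx
  set g := -P.b + P.Amap x + (t / σ) • (y - ybar)
  have h := P.T_monotone hK hT ha
  set v := pair y x - a with hv
  have e : pair g 0 + σ⁻¹ • Lam m n t (pair ybar xbar - pair y x) -
      σ⁻¹ • Lam m n t (pair ybar xbar - a) = pair g 0 - σ⁻¹ • Lam m n t v := by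
    rw [add_sub_assoc, ← smul_sub, ← map_sub, sub_sub_sub_cancel_left, sub_eq_add_neg (pair g 0),
      ← smul_neg, ← map_neg, hv, neg_sub]
  rw [e, inner_sub_left, inner_smul_left, inner_Lam ht.le, real_inner_self_eq_norm_sq] at h
  have hg : inner ℝ (pair g (0 : E n)) v = inner ℝ g v.fst := by
    rw [WithLp.prod_inner_apply]
    simp
  rw [hg] at h
  have h1 : ‖Lam m n √t v‖ ^ 2 ≤ σ * (‖g‖ * ‖v.fst‖) := by
    have h2 := real_inner_le_norm g v.fst
    have h3 : σ⁻¹ * ‖Lam m n √t v‖ ^ 2 ≤ ‖g‖ * ‖v.fst‖ := by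
      simp only [conj_trivial] at h
      linarith
    rwa [inv_mul_le_iff₀ hσ] at h3
  have hs : 0 < min √t 1 := lt_min (Real.sqrt_pos.2 ht) one_pos
  have h4 : min √t 1 * ‖v.fst‖ ≤ ‖Lam m n √t v‖ :=
    (mul_le_mul_of_nonneg_right (min_le_left _ _) (norm_nonneg _)).trans
      (norm_fst_le_norm_Lam (Real.sqrt_nonneg _) v)
  have h5 : σ * ‖g‖ ≤ min √t 1 * B := by
    have := mul_le_mul_of_nonneg_left hB hσ.le
    calc σ * ‖g‖ ≤ σ * (min √t 1 / σ * B) := this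
      _ = min √t 1 * B := by field_simp
  have hB0 : 0 ≤ B := by
    refine nonneg_of_mul_nonneg_right ((?_ : 0 ≤ σ * ‖g‖).trans h5) hs
    positivity
  have h6 : ‖Lam m n √t v‖ ^ 2 ≤ B * ‖Lam m n √t v‖ :=
    calc ‖Lam m n √t v‖ ^ 2 ≤ (σ * ‖g‖) * ‖v.fst‖ := by rw [mul_assoc]; exact h1
      _ ≤ (min √t 1 * B) * ‖v.fst‖ := by gcongr
      _ = B * (min √t 1 * ‖v.fst‖) := by ring
      _ ≤ B * ‖Lam m n √t v‖ := by gcongr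
  by_contra hlt
  push Not at hlt
  nlinarith

/-- One inexact step of the method. -/
theorem lamDist_step_le {r κ σ t ε δ : ℝ} (hE : P.ErrorBound r κ) (hK : P.K.Nonempty)
    (hr : 0 < r) (hκ : 0 < κ) (hσ : 0 < σ) (ht : 0 < t) (hδ : 0 ≤ δ) (hδ1 : δ < 1)
    (hne : P.kkt.Nonempty) {y ybar : E m} {x xbar : E n}
    (hx : IsProj P.K (xbar - σ • (P.c - P.Aadj y)) x)
    (hA : ‖gradient (P.psi σ t ybar xbar) y‖ ≤ min √t 1 / σ * ε)
    (hB : ‖gradient (P.psi σ t ybar xbar) y‖ ≤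
      δ * min √t 1 / σ * wnorm (Lam m n t) (pair y x - pair ybar xbar))
    (hz : lamDist t (pair ybar xbar) P.kkt ≤ r) :
    lamDist t (pair y x) P.kkt ≤ lamDist t (pair ybar xbar) P.kkt + ε ∧
    lamDist t (pair y x) P.kkt ≤ rate κ σ t δ * lamDist t (pair ybar xbar) P.kkt := by
  obtain ⟨a, ha⟩ := P.exists_resolvent hK hσ ht (pair ybar xbar)
  obtain ⟨h1, h2, h3⟩ := P.lamDist_resolvent_le hE hK hr hκ hσ ht hne ha hz
  have h4 := P.norm_Lam_sub_resolvent_le hK hσ ht ha hx hA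
  rw [wnorm_Lam ht.le, mul_div_assoc, mul_comm δ, mul_assoc] at hB
  have h5 := P.norm_Lam_sub_resolvent_le hK hσ ht ha hx hB
  have h6 := lamDist_le_add t (pair y x) a hne
  have h7 : ‖Lam m n √t (pair y x - pair ybar xbar)‖ ≤
      ‖Lam m n √t (pair y x - a)‖ + ‖Lam m n √t (pair ybar xbar - a)‖ := by
    rw [← sub_sub_sub_cancel_right (pair y x) (pair ybar xbar) a, map_sub (Lam m n √t) (_ - a)]
    exact norm_sub_le _ _
  refine ⟨by linarith, ?_⟩
  set D := lamDist t (pair ybar xbar) P.kkt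
  have hD0 : 0 ≤ D := lamDist_nonneg _ _ _
  set θ := κ * max t 1 / √(σ ^ 2 + κ ^ 2 * max t 1 ^ 2) with hθ
  have hθ0 : 0 ≤ θ := by positivity
  set η := ‖Lam m n √t (pair y x - a)‖
  -- (B') bounds the gap by `δ` times the actual step, itself at most `η + D`; the gap is absorbed
  -- on the left.
  have h8 : (1 - δ) * η ≤ δ * D := by
    have := h5.trans (mul_le_mul_of_nonneg_left (h7.trans (add_le_add_right h3 _)) hδ)
    linarith
  rw [rate, mul_div_assoc, ← hθ, mul_assoc, le_inv_mul_iff₀ (by linarith)]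
  have h9 : (1 - δ) * lamDist t (pair y x) P.kkt ≤ (1 - δ) * (η + θ * D) :=
    mul_le_mul_of_nonneg_left (h6.trans (add_le_add_right h1 _)) (by linarith)
  -- The argument yields the factor `(1 - δ) θ`; this nonnegative term relaxes it to the stated `(1
  -- + δ) θ`.
  have h10 : 0 ≤ δ * (θ * D) := by positivity
  linarith

end LP

/-! ### The limit of the rates -/

theorem limitRate_coe_lt_one {κ s t : ℝ} (hκ : 0 < κ) (hs : 0 < s) :
    κ * max t 1 / √(s ^ 2 + κ ^ 2 * max t 1 ^ 2) < 1 := by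
  have hγ : 0 < max t 1 := lt_max_of_lt_right one_pos
  rw [div_lt_one (Real.sqrt_pos.2 (by positivity))]
  apply Real.lt_sqrt_of_sq_lt
  rw [mul_pow]
  linarith [pow_pos hs 2]

theorem limitRate_lt_one {κ t : ℝ} (hκ : 0 < κ) {s : EReal} (hs : 0 < s) :
    limitRate κ s t < 1 := by
  rw [limitRate]
  split_ifs with h
  · exact one_pos
  · exact limitRate_coe_lt_one hκ (EReal.toReal_pos hs h)

theorem tendsto_rate {σ τ δ : ℕ → ℝ} {s : EReal} {t κ : ℝ} (hκ : 0 < κ) (hs : 0 < s)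
    (hσ : Tendsto (fun k => (σ k : EReal)) atTop (𝓝 s)) (hτ : Tendsto τ atTop (𝓝 t))
    (hδ : Tendsto δ atTop (𝓝 0)) :
    Tendsto (fun k => rate κ (σ k) (τ k) (δ k)) atTop (𝓝 (limitRate κ s t)) := by
  have hγ : Tendsto (fun k => max (τ k) 1) atTop (𝓝 (max t 1)) := hτ.max tendsto_const_nhds
  have hγ0 : 0 < max t 1 := lt_max_of_lt_right one_pos
  have h1 : Tendsto (fun k => (1 - δ k)⁻¹) atTop (𝓝 1) := by
    simpa using (tendsto_const_nhds.sub hδ).inv₀ (by norm_num : (1 : ℝ) - 0 ≠ 0)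
  have hnum : Tendsto (fun k => (1 + δ k) * (κ * max (τ k) 1)) atTop (𝓝 (κ * max t 1)) := by
    simpa using ((tendsto_const_nhds (x := (1 : ℝ))).add hδ).mul (hγ.const_mul κ)
  have hquot : Tendsto (fun k => (1 + δ k) * (κ * max (τ k) 1) /
      √(σ k ^ 2 + κ ^ 2 * max (τ k) 1 ^ 2)) atTop (𝓝 (limitRate κ s t)) := by
    rw [limitRate]
    split_ifs with h
    -- The numerator stays convergent while the root dominates `σ k`.
    · refine hnum.div_atTop ?_
      have hσ' : Tendsto σ atTop atTop := by
        rw [h] at hσ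
        exact EReal.tendsto_coe_nhds_top_iff.1 hσ
      refine tendsto_atTop_mono (fun k => ?_) hσ'
      exact Real.le_sqrt_of_sq_le (by linarith [show 0 ≤ κ ^ 2 * max (τ k) 1 ^ 2 by positivity])
    · have hsr := EReal.toReal_pos hs h
      have hσ' : Tendsto σ atTop (𝓝 s.toReal) := by
        rw [← EReal.coe_toReal h hs.ne_bot] at hσ
        exact EReal.tendsto_coe.1 hσ
      refine hnum.div ((hσ'.pow 2).add ((hγ.pow 2).const_mul _)).sqrt ?_
      exact (Real.sqrt_pos.2 (by positivity)).ne'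
  simpa [rate] using h1.mul (hδ.add hquot)

end Snipal

/-! ### Assembly of the main theorem -/

open Snipal in
theorem mainTheorem1 {m n : ℕ} (P : Snipal.LP m n)
    (hP : ∃ x, P.IsPrimalSol x) (hD : ∃ y, P.IsDualSol y) (hA : P.A.rank = m) :
    (∀ r : ℝ, 0 < r → ∃ κ : ℝ, 0 < κ ∧ P.ErrorBound r κ) ∧
    ∀ (σ τ ε δ : ℕ → ℝ) (σinf : EReal) (τinf r κ : ℝ)
      (y : ℕ → Snipal.E m) (x : ℕ → Snipal.E n),
      (∀ k, 0 < σ k) → Monotone σ → Tendsto (fun k => (σ k : EReal)) atTop (𝓝 σinf) →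
      Antitone τ → 0 < τinf → Tendsto τ atTop (𝓝 τinf) →
      (∀ k, 0 ≤ ε k) → Summable ε →
      (∀ k, 0 ≤ δ k ∧ δ k < 1) → Summable δ →
      ∑' k, ε k < r →
      0 < κ → P.ErrorBound r κ →
      Snipal.wdist (Snipal.Lam m n (τ 0)) (Snipal.pair (y 0) (x 0)) P.kkt
        ≤ ENNReal.ofReal (r - ∑' k, ε k) →
      P.IsSnipalSeq σ τ ε δ y x →
      (∀ k,
        Snipal.wdist (Snipal.Lam m n (τ (k + 1)))
            (Snipal.pair (y (k + 1)) (x (k + 1))) P.kkt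
          ≤ ENNReal.ofReal (Snipal.rate κ (σ k) (τ k) (δ k)) *
            Snipal.wdist (Snipal.Lam m n (τ k)) (Snipal.pair (y k) (x k)) P.kkt ∧
        Metric.infEDist (Snipal.pair (y (k + 1)) (x (k + 1))) P.kkt
          ≤ ENNReal.ofReal (Snipal.rate κ (σ k) (τ k) (δ k) / √(min 1 (τ (k + 1)))) *
            Snipal.wdist (Snipal.Lam m n (τ k)) (Snipal.pair (y k) (x k)) P.kkt) ∧
      Tendsto (fun k => Snipal.rate κ (σ k) (τ k) (δ k)) atTop
        (𝓝 (Snipal.limitRate κ σinf τinf)) ∧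
      Snipal.limitRate κ σinf τinf < 1 := by
  have hK := P.nonempty_K hP
  refine ⟨fun r _ => P.exists_errorBound hK r, ?_⟩
  intro σ τ ε δ σinf τinf r κ y x hσ hσm hσlim hτm hτinf hτlim hε hεs hδ hδs hεr hκ hE h0 hseq
  have hτ : ∀ k, 0 < τ k := fun k => hτinf.trans_le (hτm.le_of_tendsto hτlim k)
  have hσinf : 0 < σinf := by
    have hm : Monotone fun k => (σ k : EReal) := fun i j hij =>
      EReal.coe_le_coe_iff.2 (hσm hij)
    exact (EReal.coe_pos.2 (hσ 0)).trans_le (hm.ge_of_tendsto hσlim 0)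
  refine ⟨?_, tendsto_rate hκ hσinf hσlim hτlim hδs.tendsto_atTop_zero,
    limitRate_lt_one hκ hσinf⟩
  have hr : 0 < r := (tsum_nonneg hε).trans_lt hεr
  have hne : P.kkt.Nonempty := by
    -- The distance to the empty set is `∞`, which the bound on the starting point excludes.
    by_contra hempty
    rw [Set.not_nonempty_iff_eq_empty] at hempty
    simp [wdist, hempty] at h0
  set d : ℕ → ℝ := fun k => lamDist (τ k) (pair (y k) (x k)) P.kkt with hd
  have hstep : ∀ k, d k ≤ r → d (k + 1) ≤ d k + ε k ∧
      d (k + 1) ≤ rate κ (σ k) (τ k) (δ k) * d k := fun k hk => by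
    have hmono : d (k + 1) ≤ lamDist (τ k) (pair (y (k + 1)) (x (k + 1))) P.kkt :=
      lamDist_mono (hτm k.le_succ) _ hne
    have := P.lamDist_step_le hE hK hr hκ (hσ k) (hτ k) (hδ k).1 (hδ k).2 hne (hseq.update k)
      (hseq.critA k) (hseq.critB k) hk
    exact ⟨hmono.trans this.1, hmono.trans this.2⟩
  have hsum : ∀ k, ∑ i ∈ Finset.range k, ε i ≤ ∑' i, ε i := fun k =>
    hεs.sum_le_tsum _ fun i _ => hε i
  -- The margin `r - ∑ ε` at the start pays for all (A') errors, so every iterate stays within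
  -- weighted distance `r`.
  have hdr : ∀ k, d k ≤ r - ∑' i, ε i + ∑ i ∈ Finset.range k, ε i := by
    intro k
    induction k with
    | zero =>
      rw [wdist_Lam (hτ 0).le _ hne, ENNReal.ofReal_le_ofReal_iff (by linarith)] at h0
      simpa [hd] using h0
    | succ k ih =>
      rw [Finset.sum_range_succ]
      have := (hstep k (by linarith [hsum k])).1
      linarith
  have hrate : ∀ k, 0 ≤ rate κ (σ k) (τ k) (δ k) := fun k => by
    have h1 := (hδ k).1
    have h2 : 0 ≤ (1 - δ k)⁻¹ := inv_nonneg.2 (by linarith [(hδ k).2])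
    rw [rate]
    positivity
  intro k
  have hk := (hstep k (by linarith [hdr k, hsum k])).2
  rw [wdist_Lam (hτ k).le _ hne, wdist_Lam (hτ (k + 1)).le _ hne]
  constructor
  · rw [← ENNReal.ofReal_mul (hrate k)]
    exact ENNReal.ofReal_le_ofReal hk
  · rw [← ENNReal.ofReal_mul (div_nonneg (hrate k) (Real.sqrt_nonneg _)),
      ← ENNReal.ofReal_toReal (Metric.infEDist_ne_top hne)]
    refine ENNReal.ofReal_le_ofReal ((infDist_le_lamDist (hτ (k + 1)) _ hne).trans ?_)
    rw [div_mul_eq_mul_div]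
    gcongr
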